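/- **Setting.** Identify isometries of $\mathbb R^d$ with affine isometries. A crystal group is a discrete subgroup $\Gamma\subset\mathrm{Isom}(\mathbb R^d)$ (topology of pointwise convergence) having a compact fundamental domain $P$: the sets $\gamma(P)$, $\gamma\in\Gamma$, cover $\mathbb R^d$ and the sets $\gamma(P^\circ)$ are pairwise disjoint. Its point group $G$ is the group of linear parts of its elements, and its lattice is $\Lambda=\{k\in\mathbb R^d: (x\mapsto x+k)\in\Gamma\}$. $\Gamma$ is splitting, $\Gamma=G\ltimes\Lambda$, if its elements are exactly the maps $(b,l):x\mapsto b(x+l)$ with $b\in G$, $l\in\Lambda$. A real $d\times d$ matrix $A$ is $\Gamma$-admissible if all its complex eigenvalues have modulus $>1$ and $A\Gamma A^{-1}\subset\Gamma$. For a $d\times d$ matrix $B$, $B_{[s]}$ denotes the matrix, indexed by the multi-indices of degree $s$, such that $[(Bx)^\alpha]_{|\alpha|=s}=B_{[s]}[x^\alpha]_{|\alpha|=s}$ for all $x$. **Theorem.** Let $\Gamma=G\ltimes\Lambda$ be a splitting crystal group with point group $G=\{g_1,\dots,g_r\}$ (the $g_i$ distinct), let $A$ be $\Gamma$-admissible,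 $m=|\det A|$, and let $p\ge 0$ be an integer. Let $f:\mathbb R^d\to\mathbb C$ be integrable and compactly supported with $\int f\neq 0$, and let $F=(f\circ g_1^{-1},\dots,f\circ g_r^{-1})^T:\mathbb R^d\to\mathbb C^r$. Suppose that $F$ is $\Lambda$-refinable, that is, $$F(x)=\sum_{k\in\Lambda}\widetilde c_k\,F(Ax-k)\quad\text{for a.e. }x,$$ with $\widetilde c_k\in M_r(\mathbb C)$, only finitely many nonzero, and that the $\widetilde c_k$ have $(\Gamma,A)$-symmetry: $$(\widetilde c_k)_{i,j}=(\widetilde c_{g_{h_i}^{-1}(k)})_{1,\rho_i(j)}\quad\text{for all } i,j\text{ and } k\in\Lambda,$$ where $h$ and $\rho_i$ are the permutations of $\{1,\dots,r\}$ with $g_{h_i}=Ag_iA^{-1}$ and $g_{\rho_i(j)}=g_{h_i}^{-1}g_j$. For $\gamma=(g_i,l)\in\Gamma$ put $c_\gamma=(\widetilde c_{g_i(l)})_{1,i}$. Suppose that 1. $\sum_{\gamma\in\Gamma}c_{\gamma^{-1}}=m$; 2. for every $b\in G$ and every multi-index $\alpha$ with $|\alpha|<p$, the sums $\sum_{l\in\Lambda'}l^\alpha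 c_{(b,l)^{-1}}$ over the cosets $\Lambda'$ of $A\Lambda$ in $\Lambda$ have a common value $\beta_{b,\alpha}$; 3. for each $1\le s<p$, $1$ is not an eigenvalue of $\sum_{b\in G}\beta_{b,0}\,b_{[s]}A_{[s]}$; 4. $\sum_{\gamma\in\Gamma}|c_\gamma|^2<m$. Then $F$ has accuracy (at least) $p$ along $\Lambda$: for every polynomial $q$ in $d$ variables with complex coefficients and $\deg q<p$ there are row vectors $w_k\in\mathbb C^{1\times r}$, $k\in\Lambda$, such that $q(x)=\sum_{k\in\Lambda}w_kF(x+k)$ for a.e. $x$ (a locally finite sum). -/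

import Mathlib

open MeasureTheory

noncomputable section

namespace Crystal

/-- Euclidean space `ℝ^d`. -/
abbrev E (d : ℕ) := EuclideanSpace ℝ (Fin d)

/-- The group `Isom(ℝ^d)`; every isometry of `ℝ^d` is affine. -/
abbrev Isom (d : ℕ) := E d ≃ᵃⁱ[ℝ] E d

/-- The homomorphism taking an isometry of `ℝ^d` to its linear part in `O(d)`. -/
def linearPart (d : ℕ) : Isom d →* (E d ≃ₗᵢ[ℝ] E d) where
  toFun γ := γ.linearIsometryEquiv
  map_one' := by ext x : 1; rfl
  map_mul' γ δ := by ext x : 1; rfl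

/-- The translation `x ↦ x + k`. -/
def translation {d : ℕ} (k : E d) : Isom d := AffineIsometryEquiv.constVAdd ℝ (E d) k

/-- A compact fundamental domain: a compact set whose images under `Γ` cover `ℝ^d` and have
pairwise disjoint interiors. -/
def IsCompactFundamentalDomain {d : ℕ} (Γ : Subgroup (Isom d)) (P : Set (E d)) : Prop :=
  IsCompact P ∧ (⋃ γ ∈ Γ, γ '' P) = Set.univ ∧
    ∀ γ ∈ Γ, ∀ δ ∈ Γ, (γ '' interior P ∩ δ '' interior P).Nonempty → γ = δ

/-- A crystal group: a subgroup of `Isom(ℝ^d)` that is discrete in the topology of pointwise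
convergence (the product topology on functions `ℝ^d → ℝ^d`) and has a compact fundamental
domain. -/
def IsCrystalGroup {d : ℕ} (Γ : Subgroup (Isom d)) : Prop :=
  DiscreteTopology ((fun (γ : Isom d) (x : E d) => γ x) '' (Γ : Set (Isom d))) ∧
    ∃ P : Set (E d), IsCompactFundamentalDomain Γ P

/-- The point group `G` of `Γ`: the group of linear parts of the elements of `Γ`. -/
def pointGroup {d : ℕ} (Γ : Subgroup (Isom d)) : Subgroup (E d ≃ₗᵢ[ℝ] E d) :=
  Γ.map (linearPart d)

/-- The lattice `Λ` of vectors `k` such that the translation by `k` belongs to `Γ`. -/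
def lattice {d : ℕ} (Γ : Subgroup (Isom d)) : AddSubgroup (E d) where
  carrier := {k | translation k ∈ Γ}
  zero_mem' := by
    have h : translation (0 : E d) = 1 := by
      ext x : 1
      simp [translation]
    simp [h, Γ.one_mem]
  add_mem' {a b} ha hb := by
    have h : translation (a + b) = translation a * translation b := by
      ext x : 1
      simp [translation, add_assoc]
    simpa [h] using Γ.mul_mem ha hb
  neg_mem' {a} ha := by
    have h : translation (-a) = (translation a)⁻¹ := by
      refine eq_inv_of_mul_eq_one_left ?_
      ext x : 1
      simp [translation]
    simpa [h] using Γ.inv_mem ha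

/-- The isometry `(b, k) : x ↦ b (x + k)`. -/
def affineElt {d : ℕ} (b : E d ≃ₗᵢ[ℝ] E d) (k : E d) : Isom d :=
  b.toAffineIsometryEquiv * translation k

theorem affineElt_apply {d : ℕ} (b : E d ≃ₗᵢ[ℝ] E d) (k x : E d) :
    affineElt b k x = b (x + k) := by
  simp [affineElt, translation, add_comm]

/-- A splitting crystal group `Γ = G ⋉ Λ`: its elements are exactly the isometries
`(b, k) : x ↦ b (x + k)` with `b` in the point group and `k` in the lattice of `Γ`. -/
def IsSplittingCrystalGroup {d : ℕ} (Γ : Subgroup (Isom d)) : Prop :=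
  IsCrystalGroup Γ ∧
    ∀ γ : Isom d, γ ∈ Γ ↔ ∃ b ∈ pointGroup Γ, ∃ k ∈ lattice Γ, γ = affineElt b k

/-- The element `(b, k)` of a splitting crystal group. -/
def IsSplittingCrystalGroup.elt {d : ℕ} {Γ : Subgroup (Isom d)}
    (hΓ : IsSplittingCrystalGroup Γ) (b : pointGroup Γ) (k : lattice Γ) : Γ :=
  ⟨affineElt (b : E d ≃ₗᵢ[ℝ] E d) (k : E d), (hΓ.2 _).2 ⟨b, b.2, k, k.2, rfl⟩⟩

/-- The action `x ↦ A x` of a matrix on `ℝ^d`. -/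
def act {d : ℕ} (A : Matrix (Fin d) (Fin d) ℝ) (x : E d) : E d := Matrix.toEuclideanLin A x

/-- A `Γ`-admissible matrix: all complex eigenvalues of `A` have modulus greater than `1`, and
`A Γ A⁻¹ ⊆ Γ` (that is, for each `γ ∈ Γ` there is `δ ∈ Γ` with `δ A = A γ`). -/
def IsAdmissible {d : ℕ} (Γ : Subgroup (Isom d)) (A : Matrix (Fin d) (Fin d) ℝ) : Prop :=
  (∀ μ : ℂ, Module.End.HasEigenvalue (Matrix.toLin' (A.map (fun t : ℝ => (t : ℂ)))) μ → 1 < ‖μ‖) ∧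
    ∀ γ ∈ Γ, ∃ δ ∈ Γ, ∀ x : E d, δ (act A x) = act A (γ x)

/-- The multi-indices `α ∈ ℕ^d` of degree `s`. -/
abbrev MultiIdx (d s : ℕ) := {α : Fin d →₀ ℕ // α ∈ Finset.finsuppAntidiag Finset.univ s}

/-- The monomial `x^α`, as a complex number. -/
def monom {d : ℕ} (α : Fin d →₀ ℕ) (x : E d) : ℂ := ∏ i, ((x i : ℝ) : ℂ) ^ α i

/-- The matrix `A_[s]`, whose `α`-th row lists the coefficients of the homogeneous polynomial
`(A x)^α = ∏ i, (∑ j, A i j * x j) ^ α i`, so that `X_[s] (A x) = A_[s] X_[s] x` where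
`X_[s] x = (x^α)_{|α| = s}`. -/
def homMatrix {d : ℕ} (A : Matrix (Fin d) (Fin d) ℝ) (s : ℕ) :
    Matrix (MultiIdx d s) (MultiIdx d s) ℂ :=
  Matrix.of fun α β => MvPolynomial.coeff β.1
    (∏ i, (∑ j, MvPolynomial.C ((A i j : ℝ) : ℂ) * MvPolynomial.X j) ^ α.1 i)

/-- The defining property of `A_[s]`. -/
theorem homMatrix_mulVec {d : ℕ} (A : Matrix (Fin d) (Fin d) ℝ) (s : ℕ) (x : E d) :
    (homMatrix A s).mulVec (fun β => monom β.1 x) = fun α => monom α.1 (act A x) := by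
  funext α
  set P : MvPolynomial (Fin d) ℂ :=
    ∏ i, (∑ j, MvPolynomial.C ((A i j : ℝ) : ℂ) * MvPolynomial.X j) ^ α.1 i with hP
  have hdeg : ∑ i, α.1 i = s := (Finset.mem_finsuppAntidiag.1 α.2).1
  have hhom : P.IsHomogeneous s := by
    rw [← hdeg]
    refine MvPolynomial.IsHomogeneous.prod _ _ _ fun i _ => ?_
    have h1 : (∑ j, MvPolynomial.C ((A i j : ℝ) : ℂ) * MvPolynomial.X j :
        MvPolynomial (Fin d) ℂ).IsHomogeneous 1 := by
      refine MvPolynomial.IsHomogeneous.sum _ _ _ fun j _ => ?_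
      simpa using (MvPolynomial.isHomogeneous_C (Fin d) ((A i j : ℝ) : ℂ)).mul
        (MvPolynomial.isHomogeneous_X ℂ j)
    simpa using h1.pow (α.1 i)
  have hsub : P.support ⊆ Finset.finsuppAntidiag Finset.univ s := by
    intro β hβ
    rw [Finset.mem_finsuppAntidiag]
    refine ⟨?_, Finset.subset_univ _⟩
    have := hhom (MvPolynomial.mem_support_iff.1 hβ)
    rw [← this]
    simp [Finsupp.weight_apply, Finsupp.sum_fintype]
  have heval : MvPolynomial.eval (fun i => ((x i : ℝ) : ℂ)) P = monom α.1 (act A x) := by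
    simp [hP, monom, act, Matrix.mulVec, dotProduct]
  rw [← heval, MvPolynomial.eval_eq', Finset.sum_subset hsub]
  · rw [← Finset.sum_coe_sort]
    rfl
  · intro β _ hβ
    simp [MvPolynomial.notMem_support_iff.1 hβ]

/-- The matrix of a linear isometry in the standard basis. -/
def isomMatrix {d : ℕ} (b : E d ≃ₗᵢ[ℝ] E d) : Matrix (Fin d) (Fin d) ℝ :=
  Matrix.of fun i j => b (EuclideanSpace.single j 1) i

/-- The hypotheses on the coefficients `c_γ` of a scalar `Γ`-refinement equation under which
accuracy `p` is claimed. Here `g` enumerates the point group and `m = |det A|`: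
* `∑_γ c_{γ⁻¹} = m`;
* for `b ∈ G` and `|α| < p` the sums of `l^α c_{(b,l)⁻¹}` over the cosets `u + AΛ` of `AΛ` in `Λ`
  have a common value `β b α`;
* `1` is not an eigenvalue of `∑_b (β b 0) b_[s] A_[s]` for `1 ≤ s < p`.
All sums have finitely many nonzero terms when `c` has finite support. -/
def ScalarAccuracyConditions {d r : ℕ} {Γ : Subgroup (Isom d)} (hΓ : IsSplittingCrystalGroup Γ)
    (g : Fin r ≃ pointGroup Γ) (A : Matrix (Fin d) (Fin d) ℝ) (p : ℕ) (c : Γ → ℂ) : Prop :=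
  (∑ᶠ γ : Γ, c γ⁻¹ = ((|A.det| : ℝ) : ℂ)) ∧
    ∃ β : pointGroup Γ → (Fin d →₀ ℕ) → ℂ,
      (∀ b : pointGroup Γ, ∀ α : Fin d →₀ ℕ, α.degree < p → ∀ u : lattice Γ,
        ∑ᶠ (l : lattice Γ) (_ : ∃ k ∈ lattice Γ, (l : E d) - (u : E d) = act A k),
          monom α (l : E d) * c (hΓ.elt b l)⁻¹ = β b α) ∧
      ∀ s : ℕ, 1 ≤ s → s < p →
        ¬ Module.End.HasEigenvalue (Matrix.toLin'
            (∑ i : Fin r, β (g i) 0 •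
              (homMatrix (isomMatrix (g i : E d ≃ₗᵢ[ℝ] E d)) s * homMatrix A s))) 1

/-- `F : ℝ^d → ℂ^r` satisfies the `Λ`-refinement equation
`F(x) = ∑_{k ∈ Λ} C_k F(A x - k)` a.e., with finitely many nonzero matrix coefficients `C_k`
(`C` is finitely supported, with support in `Λ`). -/
def SatisfiesRefinementEq {d r : ℕ} (Λ : AddSubgroup (E d)) (A : Matrix (Fin d) (Fin d) ℝ)
    (C : E d →₀ Matrix (Fin r) (Fin r) ℂ) (F : E d → Fin r → ℂ) : Prop :=
  (C.support : Set (E d)) ⊆ Λ ∧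
    ∀ᵐ x : E d, F x = C.sum fun k M => M.mulVec (F (act A x - k))

/-- The `(Γ, A)`-symmetry of matrices `C_k`, `k ∈ Λ`; the row index `0` is the first index. -/
def HasSymmetry {d r : ℕ} [NeZero r] {Γ : Subgroup (Isom d)} (g : Fin r ≃ pointGroup Γ)
    (A : Matrix (Fin d) (Fin d) ℝ) (C : E d →₀ Matrix (Fin r) (Fin r) ℂ) : Prop :=
  ∃ (h : Equiv.Perm (Fin r)) (ρ : Fin r → Equiv.Perm (Fin r)),
    (∀ i, ∀ x : E d, (g (h i) : E d ≃ₗᵢ[ℝ] E d) (act A x) =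
      act A ((g i : E d ≃ₗᵢ[ℝ] E d) x)) ∧
    (∀ i j, g (ρ i j) = (g (h i))⁻¹ * g j) ∧
    ∀ i j, ∀ k ∈ lattice Γ,
      C k i j = C ((g (h i) : E d ≃ₗᵢ[ℝ] E d).symm k) 0 (ρ i j)

/-- The scalars `c_γ = (C_{g_i(l)})_{1,i}` for `γ = (g_i, l)`. Here `g_i` is the linear part of
`γ` and `g_i(l) = γ(0)`. -/
def inducedScalar {d r : ℕ} [NeZero r] {Γ : Subgroup (Isom d)} (g : Fin r ≃ pointGroup Γ)
    (C : E d →₀ Matrix (Fin r) (Fin r) ℂ) (γ : Γ) : ℂ :=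
  C ((γ : Isom d) 0) 0 (g.symm ⟨linearPart d γ, Subgroup.mem_map_of_mem _ γ.2⟩)

/-- The vector function `F = (f ∘ g_1⁻¹, …, f ∘ g_r⁻¹)`. -/
def orbitVector {d r : ℕ} {Γ : Subgroup (Isom d)} (g : Fin r ≃ pointGroup Γ) (f : E d → ℂ) :
    E d → Fin r → ℂ :=
  fun x i => f ((g i : E d ≃ₗᵢ[ℝ] E d).symm x)

/-- The space `S(F)` of functions that agree a.e. with a linear combination
`∑_{k ∈ Λ} w_k F(x + k)` of `Λ`-translates of `F`, with row vectors `w_k ∈ ℂ^{1 × r}`. All families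
of coefficients are allowed: for `F` of compact support and `Λ` discrete the sums are locally
finite, so they are the limits of their finite partial sums. -/
def translateSpace {d r : ℕ} (Λ : AddSubgroup (E d)) (F : E d → Fin r → ℂ) : Set (E d → ℂ) :=
  {q | ∃ w : Λ → Fin r → ℂ, ∀ᵐ x : E d,
    HasSum (fun k : Λ => ∑ i, w k i * F (x + (k : E d)) i) (q x)}

/-- `F` has accuracy (at least) `p` along `Λ`: every polynomial function of degree less than `p`
lies in `S(F)`. -/
def HasAccuracy {d r : ℕ} (Λ : AddSubgroup (E d)) (F : E d → Fin r → ℂ) (p : ℕ) : Prop :=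
  ∀ q : MvPolynomial (Fin d) ℂ, q.totalDegree < p →
    (fun x : E d => MvPolynomial.eval (fun i => ((x i : ℝ) : ℂ)) q) ∈ translateSpace Λ F

end Crystal

end

noncomputable section

namespace Crystal

open Filter Topology Set

/-! By the symmetry of the coefficients, the equation for `F` amounts to a scalar one, `f(x) = ∑_δ
c_{δ⁻¹} f(δ A x)`. For a linear functional `L` put `S_L q = ∑_γ L(q ∘ γ⁻¹) f ∘ γ`, a locally finite
combination of `Λ`-translates of `F` (`mem_translateSpace_of_orbitSum`). It suffices to find `L` and
`a ≠ 0` with `S_L q = a q` a.e. for all `q` of degree `< p`.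

Reindexing gives `(S_L q) ∘ τ = S_L (q ∘ τ)` for `τ ∈ Γ`. Inserting the refinement equation into
`S_L (q ∘ A)` and collecting the terms with equal `σ = δ A γ A⁻¹` gives `∑_σ L(T_σ (q ∘ σ⁻¹)) f ∘ σ
∘ A`, where `T_σ q = ∑ c_{δ⁻¹} q ∘ δ ∘ A` over the coset of `σ` (`OrbitFinite.orbitSum_comp_act`).
The coset condition makes `T_σ = T` independent of `σ` in degree `< p` (`cosetOperator_eq`). So if
`L ∘ T = L` there, `S_L` also commutes with `q ↦ q ∘ A`.

Such an `L` with `L 1 = 1` exists once `1` is not of the form `T q - q`. The coset condition gives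
`T 1 = β`, and `P = ∑_γ f ∘ γ` satisfies `P = β P ∘ A` and is `Λ`-periodic. Hence `P` is a.e. a
constant `a`, nonzero since `∫ f ≠ 0`, and `β = 1`. The eigenvalue condition excludes higher forms
fixed modulo lower terms (`exists_invariant_functional`).

Finally `D q = S_L q - a q` is equivariant and kills `1`. Inductively on the degree, `D q` is
periodic, then constant by pulling back along powers of `A`, then zero because `q - q(0)` has the
form `q' ∘ A - q'` (`ae_eq_zero_of_equivariant`). -/

/-! ### Functions invariant under translations -/

/-- Translations act ergodically on `ℝ^d`: every preimage under `u` of a measurable set is null or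
conull. -/
theorem ae_eq_const_of_forall_translation {d : ℕ} {u : E d → ℂ} (hu : AEStronglyMeasurable u)
    (h : ∀ t : E d, (fun x => u (t + x)) =ᵐ[volume] u) : ∃ c, u =ᵐ[volume] fun _ => c := by
  refine exists_eventuallyEq_const_of_forall_separating MeasurableSet fun U hU => ?_
  have hs : NullMeasurableSet (u ⁻¹' U) (volume : Measure (E d)) :=
    hu.aemeasurable.nullMeasurable hU
  have hc : EventuallyConst (u ⁻¹' U) (ae (volume : Measure (E d))) := by
    refine aeconst_of_forall_preimage_vadd_ae_eq (E d) hs fun t => ?_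
    filter_upwards [h t] with x hx
    simp only [eq_iff_iff]
    change u (t + x) ∈ U ↔ u x ∈ U
    rw [hx]
  rcases eventuallyConst_set.1 hc with h1 | h1
  · exact Or.inl h1
  · exact Or.inr h1

/-- Tested against a continuous compactly supported function, a translate of `u` depends
continuously on the shift, so invariance extends from a dense set to all shifts. -/
theorem ae_eq_const_of_dense_translation {d : ℕ} {u : E d → ℂ} (hu : LocallyIntegrable u)
    {S : Set (E d)} (hS : Dense S) (h : ∀ t ∈ S, (fun x => u (x + t)) =ᵐ[volume] u) :
    ∃ c, u =ᵐ[volume] fun _ => c := by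
  refine ae_eq_const_of_forall_translation hu.aestronglyMeasurable fun t => ?_
  have htr : ∀ t : E d, LocallyIntegrable (fun x => u (t + x)) := fun t => by
    rw [locallyIntegrable_iff] at hu ⊢
    intro K hK
    have h1 := hu (k := (fun x => t + x) '' K) (hK.image (by fun_prop))
    have := (measurePreserving_add_left volume t).integrableOn_image
      (measurableEmbedding_addLeft t) (f := u) (s := K)
    exact this.1 h1
  refine ae_eq_of_integral_contDiff_smul_eq (htr t) hu fun ψ hψ hψc => ?_
  have hconv : Continuous (fun t : E d => ∫ x, ψ (x - t) • u x) := by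
    have := (HasCompactSupport.continuous_convolution_right (f := u) (g := fun x => ψ (-x))
      (ContinuousLinearMap.lsmul ℝ ℝ).flip (μ := volume)
      (hψc.comp_homeomorph (Homeomorph.neg (E d))) hu
      (hψ.continuous.comp continuous_neg))
    refine this.congr fun t => ?_
    simp only [convolution_def]
    refine integral_congr_ae (ae_of_all _ fun x => ?_)
    simp
  have key : ∀ t : E d, ∫ x, ψ (x - t) • u x = ∫ x, ψ x • u (t + x) := fun t => by
    rw [← integral_add_left_eq_self _ t]
    simp
  have hcst : (fun t : E d => ∫ x, ψ (x - t) • u x) = fun _ => ∫ x, ψ x • u x := by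
    refine Continuous.ext_on hS hconv continuous_const fun s hs => ?_
    simp only [key s]
    refine integral_congr_ae ?_
    filter_upwards [h s hs] with x hx
    rw [add_comm s x, hx]
  rw [← key t]
  exact congrFun hcst t

/-! ### Expanding matrices -/

/-- The spectral radius is below `1`, so Gelfand's formula eventually bounds `‖B ^ k‖` by `ρ ^ k`
with `ρ < 1`. Dimension `0` is separate because the spectrum is empty there. -/
theorem tendsto_pow_zero_of_forall_eigenvalue {n : ℕ} (B : Matrix (Fin n) (Fin n) ℂ)
    (hB : ∀ μ : ℂ, Module.End.HasEigenvalue (Matrix.toLin' B) μ → ‖μ‖ < 1) :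
    Tendsto (fun k => B ^ k) atTop (𝓝 0) := by
  rcases isEmpty_or_nonempty (Fin n) with hn | hn
  · exact tendsto_const_nhds.congr fun k => Subsingleton.elim _ _
  let _ : NormedRing (Matrix (Fin n) (Fin n) ℂ) := Matrix.linftyOpNormedRing
  let _ : NormedAlgebra ℂ (Matrix (Fin n) (Fin n) ℂ) := Matrix.linftyOpNormedAlgebra
  have : CompleteSpace (Matrix (Fin n) (Fin n) ℂ) := FiniteDimensional.complete ℂ _
  have hrad : spectralRadius ℂ B < 1 := by
    obtain ⟨μ, hμ, h⟩ := spectrum.exists_nnnorm_eq_spectralRadius B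
    rw [← h]
    have : Module.End.HasEigenvalue (Matrix.toLin' B) μ := by
      rw [Module.End.hasEigenvalue_iff_mem_spectrum, Matrix.spectrum_toLin']
      exact hμ
    exact_mod_cast hB μ this
  obtain ⟨ρ, hρ1, hρ2⟩ := ENNReal.lt_iff_exists_nnreal_btwn.1 hrad
  have hlim := spectrum.pow_nnnorm_pow_one_div_tendsto_nhds_spectralRadius B
  have hev := hlim.eventually (gt_mem_nhds hρ1)
  have hρ : (ρ : ℝ) < 1 := by exact_mod_cast hρ2
  refine tendsto_zero_iff_norm_tendsto_zero.2 ?_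
  refine squeeze_zero' (Eventually.of_forall fun _ => norm_nonneg _) ?_
    (tendsto_pow_atTop_nhds_zero_of_lt_one ρ.2 hρ)
  filter_upwards [hev, eventually_gt_atTop 0] with k hk hk0
  have hk' : (‖B ^ k‖₊ : ENNReal) ≤ (ρ : ENNReal) ^ k := by
    have := ENNReal.rpow_le_rpow hk.le (Nat.cast_nonneg (α := ℝ) k)
    rwa [← ENNReal.rpow_mul, one_div, inv_mul_cancel₀ (by positivity), ENNReal.rpow_one,
      ENNReal.rpow_natCast] at this
  exact_mod_cast hk'

/-- The part of admissibility that only concerns the matrix. -/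
def IsExpanding {d : ℕ} (A : Matrix (Fin d) (Fin d) ℝ) : Prop :=
  ∀ μ : ℂ, Module.End.HasEigenvalue (Matrix.toLin' (A.map (fun t : ℝ => (t : ℂ)))) μ → 1 < ‖μ‖

theorem IsExpanding.det_ne_zero {d : ℕ} {A : Matrix (Fin d) (Fin d) ℝ} (hA : IsExpanding A) :
    A.det ≠ 0 := by
  intro h0
  have h1 : (A.map (fun t : ℝ => (t : ℂ))).det = 0 := by
    have := Complex.ofRealHom.map_det A
    simp only [h0, map_zero] at this
    exact this.symm
  obtain ⟨v, hv, hv0⟩ := Matrix.exists_mulVec_eq_zero_iff.2 h1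
  have := hA 0 (Module.End.hasEigenvalue_of_hasEigenvector (x := v)
    ⟨by rw [Module.End.mem_eigenspace_iff]; simpa using hv0, hv⟩)
  simp at this
  linarith

theorem IsExpanding.tendsto_inv_pow {d : ℕ} {A : Matrix (Fin d) (Fin d) ℝ} (hA : IsExpanding A) :
    Tendsto (fun k => A⁻¹ ^ k) atTop (𝓝 0) := by
  have hdet : IsUnit A.det := hA.det_ne_zero.isUnit
  set φ : Matrix (Fin d) (Fin d) ℝ →+* Matrix (Fin d) (Fin d) ℂ := Complex.ofRealHom.mapMatrix
    with hφ
  have hinv : φ A * φ A⁻¹ = 1 := by rw [← map_mul, Matrix.mul_nonsing_inv _ hdet, map_one]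
  have hlim := tendsto_pow_zero_of_forall_eigenvalue (φ A⁻¹) fun μ hμ => by
    obtain ⟨v, hv, hv0⟩ := hμ.exists_hasEigenvector
    rw [Module.End.mem_eigenspace_iff, Matrix.toLin'_apply] at hv
    have h2 : v = μ • (φ A).mulVec v := by
      rw [← Matrix.mulVec_smul, ← hv, Matrix.mulVec_mulVec, hinv, Matrix.one_mulVec]
    have hμ0 : μ ≠ 0 := by
      rintro rfl
      exact hv0 (by rw [h2, zero_smul])
    have h3 : (φ A).mulVec v = μ⁻¹ • v := by
      nth_rw 2 [h2]
      rw [smul_smul, inv_mul_cancel₀ hμ0, one_smul]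
    have := hA μ⁻¹ (Module.End.hasEigenvalue_of_hasEigenvector (x := v)
      ⟨by rw [Module.End.mem_eigenspace_iff]; exact h3, hv0⟩)
    rw [norm_inv] at this
    exact (one_lt_inv₀ (norm_pos_iff.2 hμ0)).1 this
  refine tendsto_pi_nhds.2 fun i => tendsto_pi_nhds.2 fun j => ?_
  have h4 := (Complex.continuous_re.tendsto _).comp
    (tendsto_pi_nhds.1 (tendsto_pi_nhds.1 hlim i) j)
  refine h4.congr fun k => ?_
  have h5 : φ A⁻¹ ^ k = φ (A⁻¹ ^ k) := (map_pow φ _ _).symm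
  change ((φ A⁻¹ ^ k : Matrix (Fin d) (Fin d) ℂ) i j).re = _
  rw [h5]
  rfl

theorem act_mul {d : ℕ} (A B : Matrix (Fin d) (Fin d) ℝ) (x : E d) :
    act (A * B) x = act A (act B x) := by
  simp [act]

theorem act_add {d : ℕ} (A : Matrix (Fin d) (Fin d) ℝ) (x y : E d) : act A (x + y) = act A x + act A y :=
  map_add _ x y

theorem act_zero {d : ℕ} (A : Matrix (Fin d) (Fin d) ℝ) : act A (0 : E d) = 0 := map_zero _

theorem act_pow {d : ℕ} (A : Matrix (Fin d) (Fin d) ℝ) (n : ℕ) (x : E d) :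
    act (A ^ n) x = (act A)^[n] x := by
  induction n generalizing x with
  | zero => simp [act]
  | succ n ih => rw [pow_succ, act_mul, ih, Function.iterate_succ_apply]

theorem IsExpanding.act_act_inv {d : ℕ} {A : Matrix (Fin d) (Fin d) ℝ} (hA : IsExpanding A)
    (x : E d) : act A (act A⁻¹ x) = x := by
  rw [← act_mul, Matrix.mul_nonsing_inv _ hA.det_ne_zero.isUnit]
  simp [act]

theorem IsExpanding.act_inv_act {d : ℕ} {A : Matrix (Fin d) (Fin d) ℝ} (hA : IsExpanding A)
    (x : E d) : act A⁻¹ (act A x) = x := by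
  rw [← act_mul, Matrix.nonsing_inv_mul _ hA.det_ne_zero.isUnit]
  simp [act]

theorem IsExpanding.quasiMeasurePreserving {d : ℕ} {A : Matrix (Fin d) (Fin d) ℝ}
    (hA : IsExpanding A) : Measure.QuasiMeasurePreserving (act A) volume volume := by
  refine Measure.LinearMap.quasiMeasurePreserving volume (Matrix.toEuclideanLin A) ?_
  rw [Matrix.toEuclideanLin, Matrix.toLpLin_eq_toLin, LinearMap.det_toLin]
  exact hA.det_ne_zero

theorem IsExpanding.tendsto_norm_act_inv_iterate {d : ℕ} {A : Matrix (Fin d) (Fin d) ℝ}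
    (hA : IsExpanding A) {R : ℝ} {y : ℕ → E d} (hy : ∀ n, ‖y n‖ ≤ R) :
    Tendsto (fun n => (act A⁻¹)^[n] (y n)) atTop (𝓝 0) := by
  let Ψ : Matrix (Fin d) (Fin d) ℝ →ₗ[ℝ] (E d →L[ℝ] E d) :=
    (Matrix.toEuclideanCLM (n := Fin d) (𝕜 := ℝ)).toAlgEquiv.toLinearMap
  have hΨ : Continuous Ψ := LinearMap.continuous_of_finiteDimensional Ψ
  have h1 : Tendsto (fun n => ‖Ψ (A⁻¹ ^ n)‖ * R) atTop (𝓝 0) := by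
    have := ((hΨ.tendsto 0).comp hA.tendsto_inv_pow).norm.mul_const R
    simpa using this
  refine squeeze_zero_norm (fun n => ?_) h1
  have h2 : (act A⁻¹)^[n] (y n) = Ψ (A⁻¹ ^ n) (y n) := by
    rw [← act_pow]; rfl
  rw [h2]
  exact ((Ψ (A⁻¹ ^ n)).le_opNorm _).trans (by gcongr; exact hy n)

/-- The points mapped into a relatively dense set by iterates of an expanding matrix are dense. -/
theorem IsExpanding.dense_iterate_preimage {d : ℕ} {A : Matrix (Fin d) (Fin d) ℝ}
    (hA : IsExpanding A) {Λ : Set (E d)} {R : ℝ} (hΛ : ∀ x, ∃ k ∈ Λ, ‖x - k‖ ≤ R) :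
    Dense {t : E d | ∃ n, (act A)^[n] t ∈ Λ} := by
  intro x
  -- A point `k n` of `Λ` near `Aⁿ x` pulls back to `A⁻ⁿ (k n)`, which tends to `x` because `A⁻ⁿ`
  -- contracts the bounded error.
  choose k hk hkR using fun n => hΛ ((act A)^[n] x)
  have hl : ∀ n, Function.LeftInverse (act A⁻¹)^[n] (act A)^[n] :=
    fun n => Function.LeftInverse.iterate hA.act_inv_act n
  have hr : ∀ n, Function.LeftInverse (act A)^[n] (act A⁻¹)^[n] :=
    fun n => Function.LeftInverse.iterate hA.act_act_inv n
  refine mem_closure_of_tendsto (f := fun n => (act A⁻¹)^[n] (k n)) (b := atTop) ?_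
    (Eventually.of_forall fun n => ⟨n, by rw [hr n]; exact hk n⟩)
  have h1 := (hA.tendsto_norm_act_inv_iterate hkR).const_sub x
  rw [sub_zero] at h1
  refine h1.congr fun n => ?_
  rw [← act_pow, ← act_pow, ← act_pow, act, map_sub, ← act, ← act, act_pow, act_pow, hl n]
  simp

/-! ### Polynomial functions and their degree filtration -/

/-- The space of polynomial functions on `ℝ^d` of degree less than `n`. -/
def polyFun (d n : ℕ) : Submodule ℂ (E d → ℂ) :=
  Submodule.span ℂ (monom '' {α : Fin d →₀ ℕ | α.degree < n})

theorem monom_mem_polyFun {d n : ℕ} {α : Fin d →₀ ℕ} (h : α.degree < n) :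
    monom α ∈ polyFun d n := Submodule.subset_span ⟨α, h, rfl⟩

theorem polyFun_mono {d m n : ℕ} (h : m ≤ n) : polyFun d m ≤ polyFun d n :=
  Submodule.span_mono (image_mono fun _ hα => lt_of_lt_of_le hα h)

theorem polyFun_zero {d : ℕ} : polyFun d 0 = ⊥ := by simp [polyFun]

theorem monom_zero {d : ℕ} : (monom 0 : E d → ℂ) = 1 := by
  ext x; simp [monom]

theorem monom_add {d : ℕ} (α β : Fin d →₀ ℕ) :
    (monom (α + β) : E d → ℂ) = monom α * monom β := by
  ext x; simp [monom, pow_add, Finset.prod_mul_distrib]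

theorem one_mem_polyFun {d n : ℕ} (hn : 0 < n) : (1 : E d → ℂ) ∈ polyFun d n := by
  rw [← monom_zero]; exact monom_mem_polyFun (by simpa using hn)

theorem polyFun_one {d : ℕ} : polyFun d 1 = Submodule.span ℂ {(1 : E d → ℂ)} := by
  rw [polyFun, ← monom_zero]
  congr 1
  ext q
  simp only [Nat.lt_one_iff, Finsupp.degree_eq_zero_iff]
  simp

instance {d n : ℕ} : FiniteDimensional ℂ (polyFun d n) := by
  refine FiniteDimensional.span_of_finite ℂ (Set.Finite.image _ ?_)
  have h : {α : Fin d →₀ ℕ | α.degree < n} ⊆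
      ⋃ s ∈ Finset.range n, (Finset.finsuppAntidiag (Finset.univ : Finset (Fin d)) s : Set _) := by
    intro α hα
    simp only [mem_iUnion, Finset.mem_range, Finset.mem_coe, Finset.mem_finsuppAntidiag]
    exact ⟨α.degree, hα, by simp [Finsupp.degree_eq_sum], by simp⟩
  exact Set.Finite.subset (Set.Finite.biUnion (Finset.finite_toSet _)
    fun _ _ => Finset.finite_toSet _) h

/-- Degree bounds are strict: `m + 1` means degree at most `m`, which added to a degree below `n`
stays below `m + n`. -/
theorem polyFun_mul {d m n : ℕ} {p q : E d → ℂ} (hp : p ∈ polyFun d (m + 1))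
    (hq : q ∈ polyFun d n) : p * q ∈ polyFun d (m + n) := by
  induction hp using Submodule.span_induction with
  | mem x hx =>
    obtain ⟨α, hα, rfl⟩ := hx
    induction hq using Submodule.span_induction with
    | mem y hy =>
      obtain ⟨β, hβ, rfl⟩ := hy
      rw [← monom_add]
      refine monom_mem_polyFun ?_
      simp only [mem_ofPred_eq] at hα hβ
      rw [map_add]
      omega
    | zero => simp
    | add x y _ _ hx hy => rw [mul_add]; exact add_mem hx hy
    | smul a x _ hx => rw [mul_smul_comm]; exact Submodule.smul_mem _ _ hx
  | zero => simp
  | add x y _ _ hx hy => rw [add_mul]; exact add_mem hx hy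
  | smul a x _ hx => rw [smul_mul_assoc]; exact Submodule.smul_mem _ _ hx

theorem coord_mem_polyFun {d : ℕ} (i : Fin d) :
    (fun x : E d => ((x i : ℝ) : ℂ)) ∈ polyFun d 2 := by
  have h : (fun x : E d => ((x i : ℝ) : ℂ)) = monom (Finsupp.single i 1) := by
    ext x
    rw [monom, Finset.prod_eq_single i] <;> simp +contextual [eq_comm]
  rw [h]
  exact monom_mem_polyFun (by simp)

theorem linear_mem_polyFun {d : ℕ} (φ : E d →ₗ[ℝ] ℝ) :
    (fun x : E d => ((φ x : ℝ) : ℂ)) ∈ polyFun d 2 := by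
  have h : (fun x : E d => ((φ x : ℝ) : ℂ)) =
      ∑ i, ((φ (EuclideanSpace.single i 1) : ℝ) : ℂ) • fun x : E d => ((x i : ℝ) : ℂ) := by
    ext x
    conv_lhs => rw [← (EuclideanSpace.basisFun (Fin d) ℝ).sum_repr x]
    simp [mul_comm]
  rw [h]
  exact sum_mem fun i _ => Submodule.smul_mem _ _ (coord_mem_polyFun i)

theorem pow_mem_polyFun {d : ℕ} {q : E d → ℂ} (hq : q ∈ polyFun d 2) (n : ℕ) :
    q ^ n ∈ polyFun d (n + 1) := by
  induction n with
  | zero => simpa using one_mem_polyFun (d := d) one_pos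
  | succ n ih =>
    rw [pow_succ']
    have := polyFun_mul hq ih
    rwa [add_comm 1] at this

theorem prod_mem_polyFun {d : ℕ} {ι : Type*} (s : Finset ι) (q : ι → E d → ℂ) (n : ι → ℕ)
    (h : ∀ i ∈ s, q i ∈ polyFun d (n i + 1)) : ∏ i ∈ s, q i ∈ polyFun d (∑ i ∈ s, n i + 1) := by
  classical
  induction s using Finset.induction_on with
  | empty => simpa using one_mem_polyFun (d := d) one_pos
  | insert a s ha ih =>
    rw [Finset.prod_insert ha, Finset.sum_insert ha, add_assoc]
    exact polyFun_mul (h a (by simp)) (ih fun i hi => h i (by simp [hi]))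

theorem comp_affine_mem_polyFun {d n : ℕ} {q : E d → ℂ} (hq : q ∈ polyFun d n)
    (M : E d →ₗ[ℝ] E d) (v : E d) : (fun x => q (M x + v)) ∈ polyFun d n := by
  induction hq using Submodule.span_induction with
  | mem q hq =>
    obtain ⟨α, hα, rfl⟩ := hq
    have h1 : (fun x => monom α (M x + v)) =
        ∏ i, (fun x : E d => (((M x + v) i : ℝ) : ℂ)) ^ α i := by
      ext x; simp [monom]
    rw [h1]
    refine polyFun_mono (m := ∑ i, α i + 1) ?_ (prod_mem_polyFun _ _ _ fun i _ =>
      pow_mem_polyFun ?_ _)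
    · rw [← Finsupp.degree_eq_sum]; exact hα
    · have h2 : (fun x : E d => (((M x + v) i : ℝ) : ℂ)) =
          (fun x : E d => (((EuclideanSpace.proj (𝕜 := ℝ) i).toLinearMap.comp M x : ℝ) : ℂ)) +
            ((v i : ℝ) : ℂ) • 1 := by
        ext x; simp
      rw [h2]
      exact add_mem (linear_mem_polyFun _) (Submodule.smul_mem _ _ (one_mem_polyFun two_pos))
  | zero => exact zero_mem _
  | add x y _ _ hx hy => exact add_mem hx hy
  | smul a x _ hx => exact Submodule.smul_mem _ a hx

theorem comp_act_mem_polyFun {d n : ℕ} {q : E d → ℂ} (hq : q ∈ polyFun d n)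
    (A : Matrix (Fin d) (Fin d) ℝ) : (fun x => q (act A x)) ∈ polyFun d n := by
  simpa [act] using comp_affine_mem_polyFun hq (Matrix.toEuclideanLin A) 0

theorem comp_add_mem_polyFun {d n : ℕ} {q : E d → ℂ} (hq : q ∈ polyFun d n) (v : E d) :
    (fun x => q (x + v)) ∈ polyFun d n :=
  comp_affine_mem_polyFun hq LinearMap.id v

theorem comp_linearIsometry_mem_polyFun {d n : ℕ} {q : E d → ℂ} (hq : q ∈ polyFun d n)
    (b : E d ≃ₗᵢ[ℝ] E d) : (fun x => q (b x)) ∈ polyFun d n := by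
  simpa using comp_affine_mem_polyFun hq b.toLinearEquiv.toLinearMap 0

theorem comp_isom_mem_polyFun {d n : ℕ} {q : E d → ℂ} (hq : q ∈ polyFun d n) (γ : Isom d) :
    (fun x => q (γ x)) ∈ polyFun d n := by
  have h : ∀ x, γ x = γ.linearIsometryEquiv x + γ 0 := fun x => by
    have := γ.map_vadd 0 x
    simpa using this
  rw [funext fun x => congrArg q (h x)]
  exact comp_affine_mem_polyFun hq γ.linearIsometryEquiv.toLinearEquiv.toLinearMap (γ 0)

/-- Differences obey a Leibniz rule, so the drop in degree passes from factors to products and only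
coordinates need computing. -/
theorem monom_translate_sub_mem_polyFun {d : ℕ} (α : Fin d →₀ ℕ) (v : E d) :
    (fun x => monom α (x + v)) - monom α ∈ polyFun d α.degree := by
  have hadd : ∀ α β : Fin d →₀ ℕ, (fun x => monom α (x + v)) - monom α ∈ polyFun d α.degree →
      (fun x => monom β (x + v)) - monom β ∈ polyFun d β.degree →
      (fun x => monom (α + β) (x + v)) - monom (α + β) ∈ polyFun d (α + β).degree := by
    intro α β hα hβ
    have h : (fun x => monom (α + β) (x + v)) - monom (α + β) =
        (fun x => monom α (x + v)) * ((fun x => monom β (x + v)) - monom β) +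
          monom β * ((fun x => monom α (x + v)) - monom α) := by
      ext x
      simp only [monom_add, Pi.sub_apply, Pi.mul_apply, Pi.add_apply]
      ring
    rw [h, map_add]
    refine add_mem (polyFun_mul (comp_add_mem_polyFun (monom_mem_polyFun (Nat.lt_succ_self _)) v)
      hβ) ?_
    rw [add_comm α.degree]
    exact polyFun_mul (monom_mem_polyFun (Nat.lt_succ_self _)) hα
  have hzero : (fun x : E d => monom 0 (x + v)) - monom 0 = 0 := by ext; simp [monom]
  induction α using Finsupp.induction_linear with
  | zero =>
    rw [hzero]
    exact zero_mem _
  | add α β hα hβ => exact hadd α β hα hβ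
  | single i n =>
    induction n with
    | zero =>
      rw [Finsupp.single_zero, hzero]
      exact zero_mem _
    | succ n ih =>
      rw [Finsupp.single_add]
      refine hadd _ _ ih ?_
      have h : (fun x => monom (Finsupp.single i 1) (x + v)) - monom (Finsupp.single i 1) =
          ((v i : ℝ) : ℂ) • (1 : E d → ℂ) := by
        ext x
        have h1 : ∀ y : E d, monom (Finsupp.single i 1) y = ((y i : ℝ) : ℂ) := fun y => by
          rw [monom, Finset.prod_eq_single i] <;>
            simp +contextual [eq_comm]
        simp [h1]
      rw [h]
      exact Submodule.smul_mem _ _ (one_mem_polyFun (by simp))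

theorem translate_sub_mem_polyFun {d n : ℕ} {q : E d → ℂ} (hq : q ∈ polyFun d (n + 1)) (v : E d) :
    (fun x => q (x + v)) - q ∈ polyFun d n := by
  let T : (E d → ℂ) →ₗ[ℂ] (E d → ℂ) := LinearMap.funLeft ℂ ℂ (fun x => x + v) - LinearMap.id
  change T q ∈ _
  suffices h : polyFun d (n + 1) ≤ (polyFun d n).comap T from h hq
  refine Submodule.span_le.2 ?_
  rintro _ ⟨α, hα, rfl⟩
  exact polyFun_mono (Nat.lt_succ_iff.1 hα) (monom_translate_sub_mem_polyFun α v)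

/-- A polynomial vanishing at all real points is zero, each coordinate ranging over an infinite
subset of `ℂ`. -/
theorem linearIndependent_monom (d : ℕ) :
    LinearIndependent ℂ (monom : (Fin d →₀ ℕ) → E d → ℂ) := by
  let ev : MvPolynomial (Fin d) ℂ →ₗ[ℂ] (E d → ℂ) :=
    { toFun := fun q x => MvPolynomial.eval (fun i => ((x i : ℝ) : ℂ)) q
      map_add' := fun p q => by ext; simp
      map_smul' := fun a q => by ext; simp [MvPolynomial.smul_eval] }
  have hev : LinearMap.ker ev = ⊥ := by
    refine LinearMap.ker_eq_bot'.2 fun q hq => ?_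
    refine MvPolynomial.funext_set (fun _ => Set.range ((↑) : ℝ → ℂ))
      (fun _ => Set.infinite_range_of_injective Complex.ofReal_injective) fun x hx => ?_
    choose y hy using fun i => hx i (mem_univ i)
    have := congrFun hq (WithLp.toLp 2 y)
    simpa [ev, hy] using this
  have h := (MvPolynomial.basisMonomials (Fin d) ℂ).linearIndependent.map' ev hev
  have hm : (monom : (Fin d →₀ ℕ) → E d → ℂ) = ev ∘ MvPolynomial.basisMonomials (Fin d) ℂ := by
    ext α x
    simp [ev, monom, MvPolynomial.eval_monomial, Finsupp.prod_fintype]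
  rw [hm]
  exact h

theorem eval_mem_polyFun {d n : ℕ} (q : MvPolynomial (Fin d) ℂ) (hq : q.totalDegree < n) :
    (fun x : E d => MvPolynomial.eval (fun i => ((x i : ℝ) : ℂ)) q) ∈ polyFun d n := by
  have h : (fun x : E d => MvPolynomial.eval (fun i => ((x i : ℝ) : ℂ)) q) =
      ∑ α ∈ q.support, q.coeff α • (monom α : E d → ℂ) := by
    ext x
    simp [MvPolynomial.eval_eq', monom]
  rw [h]
  refine sum_mem fun α hα => Submodule.smul_mem _ _ (monom_mem_polyFun ?_)
  refine lt_of_le_of_lt ?_ hq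
  rw [Finsupp.degree_eq_sum]
  have := MvPolynomial.le_totalDegree hα
  rwa [Finsupp.sum_fintype _ _ (by simp)] at this

/-- A polynomial function of degree at most `s` is a form of degree `s` plus lower terms. -/
theorem exists_form_of_mem_polyFun {d s : ℕ} {q : E d → ℂ} (hq : q ∈ polyFun d (s + 1)) :
    ∃ a : MultiIdx d s → ℂ, q - ∑ α, a α • (monom α.1 : E d → ℂ) ∈ polyFun d s := by
  induction hq using Submodule.span_induction with
  | mem q hq =>
    obtain ⟨α, hα, rfl⟩ := hq
    rcases (Nat.lt_succ_iff.1 hα).lt_or_eq with h | h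
    · exact ⟨0, by simpa using monom_mem_polyFun h⟩
    · have hα' : α ∈ Finset.finsuppAntidiag Finset.univ s := by
        rw [Finset.mem_finsuppAntidiag, ← h, Finsupp.degree_eq_sum]; simp
      refine ⟨Pi.single ⟨α, hα'⟩ 1, ?_⟩
      rw [Finset.sum_eq_single ⟨α, hα'⟩] <;> simp +contextual
  | zero => exact ⟨0, by simp⟩
  | add x y _ _ hx hy =>
    obtain ⟨a, ha⟩ := hx
    obtain ⟨b, hb⟩ := hy
    refine ⟨a + b, ?_⟩
    have := add_mem ha hb
    simp only [Pi.add_apply, add_smul, Finset.sum_add_distrib]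
    rwa [add_sub_add_comm]
  | smul c x _ hx =>
    obtain ⟨a, ha⟩ := hx
    refine ⟨c • a, ?_⟩
    have := Submodule.smul_mem _ c ha
    simpa [smul_sub, Finset.smul_sum, smul_smul] using this

theorem form_eq_zero_of_mem_polyFun {d s : ℕ} {a : MultiIdx d s → ℂ}
    (ha : ∑ α, a α • (monom α.1 : E d → ℂ) ∈ polyFun d s) : a = 0 := by
  have hdeg : ∀ α : MultiIdx d s, α.1.degree = s := fun α => by
    rw [Finsupp.degree_eq_sum]; exact (Finset.mem_finsuppAntidiag.1 α.2).1
  have hdisj := (linearIndependent_monom d).disjoint_span_image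
    (s := {α | α.degree < s}) (t := {α | α.degree = s})
    (Set.disjoint_left.2 fun α h1 h2 => by simp at h1 h2; omega)
  have h0 := Submodule.disjoint_def.1 hdisj _ ha (sum_mem fun α _ => Submodule.smul_mem _ _
    (Submodule.subset_span ⟨α.1, hdeg α, rfl⟩))
  have hli := (linearIndependent_monom d).comp (fun α : MultiIdx d s => α.1)
    Subtype.val_injective
  funext α
  exact Fintype.linearIndependent_iff.1 hli a h0 α

theorem continuous_of_mem_polyFun {d n : ℕ} {q : E d → ℂ} (hq : q ∈ polyFun d n) :
    Continuous q := by
  induction hq using Submodule.span_induction with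
  | mem q hq =>
    obtain ⟨α, _, rfl⟩ := hq
    unfold monom
    fun_prop
  | zero => exact continuous_const
  | add x y _ _ hx hy => exact hx.add hy
  | smul a x _ hx => exact hx.const_smul a

/-! ### Rigidity under an expanding matrix -/

/-- Invariance gives `q x = q (A⁻ᵏ x)`, which tends to `q 0` by continuity. -/
theorem eq_zero_of_comp_act_eq {d n : ℕ} {A : Matrix (Fin d) (Fin d) ℝ} (hA : IsExpanding A)
    {q : E d → ℂ} (hq : q ∈ polyFun d n) (h0 : q 0 = 0) (h : ∀ x, q (act A x) = q x) : q = 0 := by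
  funext x
  have h1 : ∀ k, q ((act A⁻¹)^[k] x) = q x := fun k => by
    induction k with
    | zero => rfl
    | succ k ih => rw [Function.iterate_succ_apply', ← h, hA.act_act_inv, ih]
  have h2 := ((continuous_of_mem_polyFun hq).tendsto 0).comp
    (hA.tendsto_norm_act_inv_iterate (y := fun _ => x) (R := ‖x‖) fun _ => le_rfl)
  have h3 : Tendsto (fun _ : ℕ => q x) atTop (𝓝 (q 0)) := h2.congr h1
  rw [h0] at h3
  exact tendsto_nhds_unique tendsto_const_nhds h3

/-- The operator `q ↦ q ∘ A - q` is onto the polynomials vanishing at the origin. -/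
theorem exists_comp_act_sub_eq {d n : ℕ} {A : Matrix (Fin d) (Fin d) ℝ} (hA : IsExpanding A)
    {q : E d → ℂ} (hq : q ∈ polyFun d n) (h0 : q 0 = 0) :
    ∃ q' ∈ polyFun d n, q = (fun x => q' (act A x)) - q' := by
  let V : Submodule ℂ (E d → ℂ) := polyFun d n ⊓ LinearMap.ker (LinearMap.proj (0 : E d))
  let T : (E d → ℂ) →ₗ[ℂ] (E d → ℂ) := LinearMap.funLeft ℂ ℂ (act A) - LinearMap.id
  have hT : ∀ q ∈ V, T q ∈ V := fun q hq => by
    refine ⟨sub_mem (comp_act_mem_polyFun hq.1 A) hq.1, ?_⟩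
    have : act A 0 = 0 := by simp [act]
    simp [T, LinearMap.funLeft_apply, this]
  have : FiniteDimensional ℂ V := Submodule.finiteDimensional_inf_left _ _
  -- The space `V` of polynomials vanishing at the origin is finite-dimensional, so injectivity
  -- gives surjectivity.
  have hinj : Function.Injective (T.restrict hT) := by
    refine (injective_iff_map_eq_zero _).2 fun q hq => ?_
    have h1 : T q.1 = 0 := congrArg Subtype.val hq
    refine Subtype.ext (eq_zero_of_comp_act_eq hA q.2.1 q.2.2 fun x => ?_)
    exact sub_eq_zero.1 (congrFun h1 x)
  obtain ⟨q', hq'⟩ := LinearMap.injective_iff_surjective.1 hinj ⟨q, hq, h0⟩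
  exact ⟨q', q'.2.1, (congrArg Subtype.val hq').symm⟩

/-- A locally integrable function that is periodic with respect to a relatively dense set, and
whose pull-backs under the expanding map are again so, is constant. -/
theorem ae_eq_const_of_periodic_of_comp_act {d : ℕ} {A : Matrix (Fin d) (Fin d) ℝ}
    (hA : IsExpanding A) {Λ : Set (E d)} {R : ℝ} (hΛ : ∀ x, ∃ k ∈ Λ, ‖x - k‖ ≤ R)
    {u : E d → ℂ} (hu : LocallyIntegrable u)
    (h : ∀ n : ℕ, ∃ v : E d → ℂ, (∀ k ∈ Λ, (fun x => v (x + k)) =ᵐ[volume] v) ∧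
      u =ᵐ[volume] v ∘ (act A)^[n]) : ∃ c, u =ᵐ[volume] fun _ => c := by
  refine ae_eq_const_of_dense_translation hu (hA.dense_iterate_preimage hΛ) ?_
  -- With `Aⁿ t ∈ Λ`: `u (x + t) = v (Aⁿ x + Aⁿ t) = v (Aⁿ x) = u x`.
  rintro t ⟨n, hn⟩
  obtain ⟨v, hv, huv⟩ := h n
  have h1 := (measurePreserving_add_right volume t).quasiMeasurePreserving.ae_eq_comp huv
  have h2 := (hA.quasiMeasurePreserving.iterate n).ae_eq_comp (hv _ hn)
  filter_upwards [h1, h2, huv] with x hx1 hx2 hx3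
  simp only [Function.comp_apply] at hx1 hx2 hx3
  rw [hx1, hx3, ← hx2, ← act_pow, ← act_pow, ← act_pow, act_add]

/-- A linear family of functions, indexed by polynomials of degree less than `p`, that is
equivariant under translations in a relatively dense set and under an expanding matrix vanishes
if it vanishes at the constants. -/
theorem ae_eq_zero_of_equivariant {d p : ℕ} {A : Matrix (Fin d) (Fin d) ℝ}
    (hA : IsExpanding A) {Λ : Set (E d)} {R : ℝ} (hΛ : ∀ x, ∃ k ∈ Λ, ‖x - k‖ ≤ R)
    (D : (E d → ℂ) →ₗ[ℂ] (E d → ℂ)) (hloc : ∀ q ∈ polyFun d p, LocallyIntegrable (D q))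
    (htr : ∀ q, ∀ k ∈ Λ, ∀ x, D q (x + k) = D (fun y => q (y + k)) x)
    (hact : ∀ q ∈ polyFun d p, D (fun x => q (act A x)) =ᵐ[volume] D q ∘ act A)
    (hone : D 1 =ᵐ[volume] 0) : ∀ n ≤ p, ∀ q ∈ polyFun d n, D q =ᵐ[volume] 0 := by
  intro n
  induction n with
  | zero =>
    intro _ q hq
    rw [polyFun_zero, Submodule.mem_bot] at hq
    rw [hq, map_zero]
  | succ n ih =>
    intro hn
    have hle := polyFun_mono (d := d) hn
    -- The defect of periodicity is `D` applied to a difference of `q`, which has lower degree.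
    have hper : ∀ q ∈ polyFun d (n + 1), ∀ k ∈ Λ, (fun x => D q (x + k)) =ᵐ[volume] D q := by
      intro q hq k hk
      filter_upwards [ih (by omega) _ (translate_sub_mem_polyFun hq k)] with x hx
      rw [map_sub] at hx
      rw [htr q k hk]
      exact sub_eq_zero.1 hx
    -- The polynomial `q'` is `q ∘ A⁻ᵐ`, again of degree at most `n`.
    have hpull : ∀ m : ℕ, ∀ q ∈ polyFun d (n + 1), ∃ q' ∈ polyFun d (n + 1),
        D q =ᵐ[volume] D q' ∘ (act A)^[m] := by
      intro m
      induction m with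
      | zero => exact fun q hq => ⟨q, hq, by simp⟩
      | succ m ihm =>
        intro q hq
        obtain ⟨q', hq', h⟩ := ihm q hq
        have hq'' := comp_act_mem_polyFun hq' A⁻¹
        refine ⟨_, hq'', h.trans ?_⟩
        have h1 := (hA.quasiMeasurePreserving.iterate m).ae_eq_comp (hact _ (hle hq''))
        simp only [hA.act_inv_act] at h1
        rwa [Function.iterate_succ']
    have hconst : ∀ q ∈ polyFun d (n + 1), ∃ c, D q =ᵐ[volume] fun _ => c := fun q hq =>
      ae_eq_const_of_periodic_of_comp_act hA hΛ (hloc q (hle hq)) fun m => by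
        obtain ⟨q', hq', h⟩ := hpull m q hq
        exact ⟨D q', hper q' hq', h⟩
    -- With `q = q' ∘ A - q'` and `D q'` constant, `D q = D q' ∘ A - D q'` vanishes.
    have hvan : ∀ q ∈ polyFun d (n + 1), q 0 = 0 → D q =ᵐ[volume] 0 := by
      intro q hq h0
      obtain ⟨q', hq', rfl⟩ := exists_comp_act_sub_eq hA hq h0
      obtain ⟨c, hc⟩ := hconst q' hq'
      rw [map_sub]
      filter_upwards [hact q' (hle hq'), hc, hA.quasiMeasurePreserving.ae_eq_comp hc]
        with x h1 h2 h3
      simp only [Function.comp_apply] at h1 h3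
      simp [h1, h2, h3]
    intro q hq
    have h1 := hvan (q - q 0 • 1)
      (sub_mem hq (Submodule.smul_mem _ _ (one_mem_polyFun n.succ_pos))) (by simp)
    rw [map_sub, map_smul] at h1
    filter_upwards [h1, hone] with x hx1 hx2
    simpa [hx2] using hx1

/-! ### Structure of splitting crystal groups -/

theorem isom_eq {d : ℕ} (γ : Isom d) (x : E d) : γ x = linearPart d γ x + γ 0 := by
  have h : γ (x + 0) = linearPart d γ x + γ 0 := γ.map_vadd 0 x
  rwa [add_zero] at h

theorem linearPart_affineElt {d : ℕ} (b : E d ≃ₗᵢ[ℝ] E d) (k : E d) :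
    linearPart d (affineElt b k) = b := by
  ext x : 1
  have h := isom_eq (affineElt b k) x
  rw [affineElt_apply, affineElt_apply, zero_add, map_add] at h
  exact (add_right_cancel h).symm

variable {d : ℕ} {Γ : Subgroup (Isom d)}

theorem translation_apply (k x : E d) : translation k x = x + k := by
  simp [translation, add_comm]

theorem mem_lattice {k : E d} : k ∈ lattice Γ ↔ translation k ∈ Γ := Iff.rfl

theorem mem_lattice_of_forall {k : E d} {γ : Isom d} (hγ : γ ∈ Γ) (h : ∀ x, γ x = x + k) :
    k ∈ lattice Γ := by
  have : γ = translation k := by ext x : 1; rw [h, translation_apply]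
  exact mem_lattice.2 (this ▸ hγ)

theorem linearPart_apply_mem_lattice {γ : Isom d} (hγ : γ ∈ Γ) {k : E d} (hk : k ∈ lattice Γ) :
    linearPart d γ k ∈ lattice Γ := by
  refine mem_lattice_of_forall (Γ.mul_mem (Γ.mul_mem hγ (mem_lattice.1 hk)) (Γ.inv_mem hγ))
    fun x => ?_
  have h1 : ∀ y, γ (y + k) = γ y + linearPart d γ k := fun y => by
    rw [isom_eq γ (y + k), isom_eq γ y, map_add]; abel
  have h2 : γ (γ⁻¹ x) = x := γ.apply_symm_apply x
  change γ (translation k (γ⁻¹ x)) = _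
  rw [translation_apply, h1, h2]

theorem pointGroup_apply_mem_lattice {b : E d ≃ₗᵢ[ℝ] E d} (hb : b ∈ pointGroup Γ) {k : E d}
    (hk : k ∈ lattice Γ) : b k ∈ lattice Γ := by
  obtain ⟨γ, hγ, rfl⟩ := hb
  exact linearPart_apply_mem_lattice hγ hk

theorem IsAdmissible.isExpanding {A : Matrix (Fin d) (Fin d) ℝ} (hA : IsAdmissible Γ A) :
    IsExpanding A := hA.1

/-- A splitting crystal group is in bijection with the product of point group and lattice. -/
def IsSplittingCrystalGroup.eltEquiv (hΓ : IsSplittingCrystalGroup Γ) :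
    pointGroup Γ × lattice Γ ≃ Γ :=
  Equiv.ofBijective (fun a => hΓ.elt a.1 a.2) <| by
    constructor
    · rintro ⟨b, k⟩ ⟨b', k'⟩ h
      have h1 : affineElt (b : E d ≃ₗᵢ[ℝ] E d) (k : E d) = affineElt b' k' :=
        congrArg Subtype.val h
      have h2 := congrArg (linearPart d) h1
      rw [linearPart_affineElt, linearPart_affineElt] at h2
      obtain rfl := Subtype.ext h2
      have h3 := congrArg (fun γ : Isom d => γ 0) h1
      simp only [affineElt_apply, zero_add] at h3
      obtain rfl := Subtype.ext (b.1.injective h3)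
      rfl
    · rintro ⟨γ, hγ⟩
      obtain ⟨b, hb, k, hk, rfl⟩ := (hΓ.2 γ).1 hγ
      exact ⟨(⟨b, hb⟩, ⟨k, hk⟩), rfl⟩

theorem IsSplittingCrystalGroup.eltEquiv_apply (hΓ : IsSplittingCrystalGroup Γ)
    (b : pointGroup Γ) (k : lattice Γ) (x : E d) :
    (hΓ.eltEquiv (b, k) : Isom d) x = (b : E d ≃ₗᵢ[ℝ] E d) (x + k) := affineElt_apply _ _ _

theorem IsCrystalGroup.discreteTopology_lattice (hΓ : IsCrystalGroup Γ) :
    DiscreteTopology (lattice Γ) := by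
  have := hΓ.1
  let φ : lattice Γ → (fun (γ : Isom d) (x : E d) => γ x) '' (Γ : Set (Isom d)) :=
    fun k => ⟨fun x => translation (k : E d) x, ⟨_, k.2, rfl⟩⟩
  refine DiscreteTopology.of_continuous_injective (f := φ) ?_ ?_
  · refine Continuous.subtype_mk (continuous_pi fun x => ?_) _
    simp only [translation_apply]
    fun_prop
  · intro k l h
    have := congrFun (congrArg Subtype.val h) 0
    simpa [φ, translation_apply] using this

/-- Each point is `b (y + k) = b y + b k` with `y` in the bounded set `P`, and `b k` is a lattice
point at distance `‖y‖`. -/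
theorem IsSplittingCrystalGroup.exists_lattice_near (hΓ : IsSplittingCrystalGroup Γ) :
    ∃ R : ℝ, ∀ x : E d, ∃ k ∈ lattice Γ, ‖x - k‖ ≤ R := by
  obtain ⟨P, hPc, hcov, -⟩ := hΓ.1.2
  obtain ⟨R, hR⟩ := hPc.isBounded.exists_norm_le
  refine ⟨R, fun x => ?_⟩
  have hx : x ∈ ⋃ γ ∈ Γ, γ '' P := hcov ▸ mem_univ x
  simp only [mem_iUnion] at hx
  obtain ⟨γ, hγ, y, hy, rfl⟩ := hx
  obtain ⟨b, hb, k, hk, rfl⟩ := (hΓ.2 γ).1 hγ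
  refine ⟨b k, pointGroup_apply_mem_lattice hb hk, ?_⟩
  rw [affineElt_apply, map_add, add_sub_cancel_right, b.norm_map]
  exact hR y hy

theorem IsSplittingCrystalGroup.finite_lattice_norm_le (hΓ : IsSplittingCrystalGroup Γ) (R : ℝ) :
    {k : lattice Γ | ‖(k : E d)‖ ≤ R}.Finite := by
  have := hΓ.1.discreteTopology_lattice
  have h := Metric.finite_isBounded_inter_isClosed
    (isDiscrete_iff_discreteTopology.2 ‹_›) (Metric.isBounded_closedBall (x := (0 : E d)) (r := R))
    (AddSubgroup.isClosed_of_discrete (H := lattice Γ))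
  refine (h.preimage (f := ((↑) : lattice Γ → E d)) Subtype.val_injective.injOn).subset ?_
  intro k hk
  exact ⟨by simpa using hk, k.2⟩

theorem IsSplittingCrystalGroup.finite_meeting (hΓ : IsSplittingCrystalGroup Γ)
    [Finite (pointGroup Γ)] (R S : ℝ) :
    {γ : Γ | ∃ x : E d, ‖x‖ ≤ R ∧ ‖(γ : Isom d) x‖ ≤ S}.Finite := by
  refine (((Set.finite_univ (α := pointGroup Γ)).prod
    (hΓ.finite_lattice_norm_le (R + S))).image hΓ.eltEquiv).subset ?_
  rintro γ ⟨x, hx, hγ⟩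
  obtain ⟨⟨b, k⟩, rfl⟩ := hΓ.eltEquiv.surjective γ
  refine ⟨(b, k), ⟨mem_univ _, ?_⟩, rfl⟩
  rw [hΓ.eltEquiv_apply, LinearIsometryEquiv.norm_map] at hγ
  have h1 : (k : E d) = (x + k) - x := by abel
  change ‖(k : E d)‖ ≤ _
  rw [h1]
  exact (norm_sub_le _ _).trans (by linarith)

theorem IsSplittingCrystalGroup.countable (hΓ : IsSplittingCrystalGroup Γ)
    [Finite (pointGroup Γ)] : Countable Γ := by
  have := hΓ.1.discreteTopology_lattice
  have : Countable (lattice Γ) := TopologicalSpace.separableSpace_iff_countable.1 inferInstance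
  exact hΓ.eltEquiv.symm.injective.countable

theorem measurePreserving_isom (γ : Isom d) :
    MeasurePreserving (fun x : E d => γ x) volume volume := by
  have h : (fun x : E d => γ x) = (fun x => x + γ 0) ∘ linearPart d γ := by
    funext x
    exact isom_eq γ x
  rw [h]
  exact (measurePreserving_add_right volume _).comp (linearPart d γ).measurePreserving

/-! ### Orbit sums and the refinement equation -/

/-- Only finitely many elements of `Γ` move points of a given ball into the support of `f`. -/
def OrbitFinite (Γ : Subgroup (Isom d)) (f : E d → ℂ) : Prop :=
  ∀ R : ℝ, {γ : Γ | ∃ x : E d, ‖x‖ ≤ R ∧ f ((γ : Isom d) x) ≠ 0}.Finite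

theorem IsSplittingCrystalGroup.orbitFinite (hΓ : IsSplittingCrystalGroup Γ)
    [Finite (pointGroup Γ)] {f : E d → ℂ} (hf : HasCompactSupport f) : OrbitFinite Γ f := by
  intro R
  obtain ⟨S, hS⟩ := hf.isCompact.isBounded.exists_norm_le
  refine (hΓ.finite_meeting R S).subset ?_
  rintro γ ⟨x, hx, hγ⟩
  exact ⟨x, hx, hS _ (subset_tsupport _ hγ)⟩

theorem OrbitFinite.finite_support {f : E d → ℂ} (hf : OrbitFinite Γ f) (w : Γ → ℂ) (x : E d) :
    (Function.support fun γ : Γ => w γ * f ((γ : Isom d) x)).Finite :=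
  (hf ‖x‖).subset fun _ hγ => ⟨x, le_rfl, right_ne_zero_of_mul hγ⟩

theorem OrbitFinite.locallyIntegrable {f : E d → ℂ} (hf : OrbitFinite Γ f) (hfi : Integrable f)
    (w : Γ → ℂ) : LocallyIntegrable fun x => ∑ᶠ γ : Γ, w γ * f ((γ : Isom d) x) := by
  intro x
  refine ⟨Metric.ball x 1, Metric.ball_mem_nhds x one_pos, ?_⟩
  have hint : Integrable fun y => ∑ γ ∈ (hf (‖x‖ + 1)).toFinset, w γ * f ((γ : Isom d) y) :=
    integrable_finsetSum _ fun γ _ =>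
      ((measurePreserving_isom (γ : Isom d)).integrable_comp_of_integrable hfi).const_mul _
  refine hint.integrableOn.congr_fun (fun y hy => ?_) measurableSet_ball
  refine (finsum_eq_sum_of_support_subset _ fun γ hγ => ?_).symm
  simp only [Finite.coe_toFinset]
  refine ⟨y, ?_, right_ne_zero_of_mul hγ⟩
  have : ‖y‖ ≤ ‖x‖ + ‖y - x‖ := norm_le_norm_add_norm_sub' y x
  rw [Metric.mem_ball, dist_eq_norm] at hy
  linarith

/-- The function `∑_γ L(q ∘ γ⁻¹) f ∘ γ`, linear in `q`. -/
def OrbitFinite.orbitSum {f : E d → ℂ} (hf : OrbitFinite Γ f) (L : (E d → ℂ) →ₗ[ℂ] ℂ) :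
    (E d → ℂ) →ₗ[ℂ] (E d → ℂ) where
  toFun q x := ∑ᶠ γ : Γ, L (fun y => q ((γ : Isom d)⁻¹ y)) * f ((γ : Isom d) x)
  map_add' p q := by
    ext x
    simp only [Pi.add_apply]
    rw [← finsum_add_distrib (hf.finite_support _ x) (hf.finite_support _ x)]
    refine finsum_congr fun γ => ?_
    rw [← add_mul, ← map_add]
    rfl
  map_smul' a q := by
    ext x
    simp only [Pi.smul_apply, RingHom.id_apply]
    rw [smul_finsum' _ (hf.finite_support _ x)]
    refine finsum_congr fun γ => ?_
    rw [smul_eq_mul, ← mul_assoc, ← smul_eq_mul a, ← map_smul]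
    rfl

theorem OrbitFinite.orbitSum_apply {f : E d → ℂ} (hf : OrbitFinite Γ f)
    (L : (E d → ℂ) →ₗ[ℂ] ℂ) (q : E d → ℂ) (x : E d) : hf.orbitSum L q x =
      ∑ᶠ γ : Γ, L (fun y => q ((γ : Isom d)⁻¹ y)) * f ((γ : Isom d) x) := rfl

/-- Reindex by `γ ↦ γ τ`. For `τ` a translation this is the `Λ`-equivariance. -/
theorem OrbitFinite.orbitSum_comp {f : E d → ℂ} (hf : OrbitFinite Γ f)
    (L : (E d → ℂ) →ₗ[ℂ] ℂ) (q : E d → ℂ) (τ : Γ) (x : E d) :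
    hf.orbitSum L q ((τ : Isom d) x) = hf.orbitSum L (fun y => q ((τ : Isom d) y)) x := by
  rw [orbitSum_apply, orbitSum_apply]
  refine Eq.trans (finsum_congr fun γ => ?_) (finsum_comp_equiv (Equiv.mulRight τ))
  have h : ∀ y, (τ : Isom d) (((γ * τ : Γ) : Isom d)⁻¹ y) = (γ : Isom d)⁻¹ y := fun y => by
    rw [Subgroup.coe_mul, mul_inv_rev]
    exact (τ : Isom d).apply_symm_apply _
  simp only [Equiv.coe_mulRight, h]
  rfl

/-- The coset relation `δ⁻¹ σ ∈ A Γ A⁻¹`. -/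
def SameCoset (Γ : Subgroup (Isom d)) (A : Matrix (Fin d) (Fin d) ℝ) (σ δ : Isom d) : Prop :=
  ∃ γ ∈ Γ, ∀ x : E d, σ (act A x) = δ (act A (γ x))

open Classical in
/-- The operator `q ↦ ∑_δ c_δ q ∘ δ ∘ A`, where `δ ∈ D` runs over the coset of `σ`. -/
def cosetOperator (A : Matrix (Fin d) (Fin d) ℝ) (D : Finset Γ) (c : Γ → ℂ) (σ : Γ) :
    (E d → ℂ) →ₗ[ℂ] (E d → ℂ) :=
  ∑ δ ∈ D.filter fun δ : Γ => SameCoset Γ A (σ : Isom d) δ,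
    c δ • LinearMap.funLeft ℂ ℂ fun x => (δ : Isom d) (act A x)

open Classical in
theorem cosetOperator_apply (A : Matrix (Fin d) (Fin d) ℝ) (D : Finset Γ) (c : Γ → ℂ) (σ : Γ)
    (q : E d → ℂ) : cosetOperator A D c σ q =
      ∑ δ ∈ D.filter fun δ : Γ => SameCoset Γ A (σ : Isom d) δ, c δ • fun x => q ((δ : Isom d) (act A x)) := by
  simp only [cosetOperator, LinearMap.sum_apply, LinearMap.smul_apply]
  rfl

/-- The scalar refinement equation `f(x) = ∑_{δ ∈ D} c_δ f(δ A x)`. -/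
def IsRefinable (A : Matrix (Fin d) (Fin d) ℝ) (D : Finset Γ) (c : Γ → ℂ) (f : E d → ℂ) : Prop :=
  ∀ᵐ x : E d, f x = ∑ δ ∈ D, c δ * f ((δ : Isom d) (act A x))

/-- For fixed `δ`, the map `γ ↦ σ = δ A γ A⁻¹` is a bijection of `Γ` onto the `σ` in the same coset
as `δ`, and `q ∘ A ∘ γ⁻¹ = q ∘ σ⁻¹ ∘ δ ∘ A`. Exchanging the sums over `δ` and `σ` produces the coset
operator. -/
theorem OrbitFinite.orbitSum_comp_act [Countable Γ] {f : E d → ℂ} (hf : OrbitFinite Γ f)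
    (L : (E d → ℂ) →ₗ[ℂ] ℂ) {A : Matrix (Fin d) (Fin d) ℝ} (hA : IsAdmissible Γ A)
    {D : Finset Γ} {c : Γ → ℂ} (hD : IsRefinable A D c f) (q : E d → ℂ) :
    ∀ᵐ x : E d, hf.orbitSum L (fun y => q (act A y)) x =
      ∑ᶠ σ : Γ, L (cosetOperator A D c σ fun y => q ((σ : Isom d)⁻¹ y)) *
        f ((σ : Isom d) (act A x)) := by
  classical
  -- Countability of `Γ` gives one null set outside which the equation holds along the whole orbit
  -- of `x`.
  have hall : ∀ᵐ x : E d, ∀ γ : Γ, f ((γ : Isom d) x) =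
      ∑ δ ∈ D, c δ * f ((δ : Isom d) (act A ((γ : Isom d) x))) :=
    ae_all_iff.2 fun γ => (measurePreserving_isom (γ : Isom d)).quasiMeasurePreserving.ae hD
  choose φ hφ using fun γ : Γ => hA.2 γ γ.2
  let ι : Γ → Γ → Γ := fun δ γ => δ * ⟨φ γ, (hφ γ).1⟩
  have hι : ∀ δ γ x, (ι δ γ : Isom d) (act A x) = (δ : Isom d) (act A ((γ : Isom d) x)) := by
    intro δ γ x
    rw [← (hφ γ).2 x]
    rfl
  have hinj : ∀ δ, Function.Injective (ι δ) := by
    intro δ γ γ' h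
    refine Subtype.ext (AffineIsometryEquiv.ext fun x => ?_)
    have h1 := hι δ γ x
    rw [h, hι δ γ' x] at h1
    have h2 := (δ : Isom d).injective h1
    rw [← hA.isExpanding.act_inv_act ((γ : Isom d) x), ← h2, hA.isExpanding.act_inv_act]
  have hrange : ∀ δ σ : Γ, SameCoset Γ A (σ : Isom d) δ ↔ σ ∈ Set.range (ι δ) := by
    intro δ σ
    constructor
    · rintro ⟨γ, hγ, h⟩
      refine ⟨⟨γ, hγ⟩, Subtype.ext (AffineIsometryEquiv.ext fun x => ?_)⟩
      rw [← hA.isExpanding.act_act_inv x, hι]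
      exact (h _).symm
    · rintro ⟨γ, rfl⟩
      exact ⟨γ, γ.2, hι δ γ⟩
  filter_upwards [hall] with x hx
  let G : Γ → Γ → ℂ := fun δ σ =>
    c δ * L (fun y => q ((σ : Isom d)⁻¹ ((δ : Isom d) (act A y)))) *
      f ((σ : Isom d) (act A x))
  have hG : ∀ δ, (Function.support (G δ)).Finite := fun δ => hf.finite_support _ _
  calc hf.orbitSum L (fun y => q (act A y)) x
      = ∑ᶠ γ : Γ, ∑ δ ∈ D, G δ (ι δ γ) := by
        rw [orbitSum_apply]
        refine finsum_congr fun γ => ?_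
        rw [hx γ, Finset.mul_sum]
        refine Finset.sum_congr rfl fun δ _ => ?_
        have h1 : ∀ y, (ι δ γ : Isom d)⁻¹ ((δ : Isom d) (act A y)) =
            act A ((γ : Isom d)⁻¹ y) := fun y => by
          have h2 := hι δ γ ((γ : Isom d)⁻¹ y)
          have h3 : (γ : Isom d) ((γ : Isom d)⁻¹ y) = y := (γ : Isom d).apply_symm_apply y
          rw [h3] at h2
          rw [← h2]
          exact (ι δ γ : Isom d).symm_apply_apply _
        simp only [G, h1, hι]
        ring
    _ = ∑ δ ∈ D, ∑ᶠ γ : Γ, G δ (ι δ γ) :=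
        finsum_sum_comm _ _ fun δ _ => (hG δ).preimage (hinj δ).injOn
    _ = ∑ δ ∈ D, ∑ᶠ σ : Γ, (if SameCoset Γ A (σ : Isom d) δ then G δ σ else 0) := by
        refine Finset.sum_congr rfl fun δ _ => ?_
        rw [← finsum_mem_range (hinj δ)]
        refine finsum_congr fun σ => ?_
        rw [finsum_eq_if]
        simp only [hrange]
    _ = ∑ᶠ σ : Γ, ∑ δ ∈ D, (if SameCoset Γ A (σ : Isom d) δ then G δ σ else 0) := by
        refine (finsum_sum_comm _ _ fun δ _ => (hG δ).subset fun σ hσ => ?_).symm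
        simp only [Function.mem_support] at hσ ⊢
        exact (ite_ne_right_iff.1 hσ).2
    _ = _ := by
        refine finsum_congr fun σ => ?_
        rw [cosetOperator_apply, map_sum, Finset.sum_mul, Finset.sum_filter]
        refine Finset.sum_congr rfl fun δ _ => ?_
        split_ifs
        · rw [map_smul, smul_eq_mul]
        · rfl

/-! ### Periodization and the integral -/

/-- If `v ≠ 0` is orthogonal to `Λ`, the multiple of `v` of length `R + 1` is farther than `R` from
every lattice point, by Cauchy–Schwarz. -/
theorem IsSplittingCrystalGroup.span_lattice (hΓ : IsSplittingCrystalGroup Γ) :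
    Submodule.span ℝ (lattice Γ : Set (E d)) = ⊤ := by
  obtain ⟨R, hR⟩ := hΓ.exists_lattice_near
  rw [← Submodule.orthogonal_eq_bot_iff, Submodule.eq_bot_iff]
  intro v hv
  by_contra hv0
  have hpos : 0 < ‖v‖ := norm_pos_iff.2 hv0
  obtain ⟨k, hk, hkR⟩ := hR (((R + 1) / ‖v‖) • v)
  have h1 : inner ℝ v (((R + 1) / ‖v‖) • v - k) = (R + 1) * ‖v‖ := by
    rw [inner_sub_right, Submodule.inner_left_of_mem_orthogonal (Submodule.subset_span hk) hv,
      inner_smul_right, real_inner_self_eq_norm_sq]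
    field_simp
    ring
  have h2 := real_inner_le_norm v (((R + 1) / ‖v‖) • v - k)
  rw [h1] at h2
  nlinarith

theorem IsSplittingCrystalGroup.exists_fundamentalDomain (hΓ : IsSplittingCrystalGroup Γ) :
    ∃ S : Set (E d), IsAddFundamentalDomain (lattice Γ) S volume := by
  let M : Submodule ℤ (E d) := (lattice Γ).toIntSubmodule
  have : DiscreteTopology M := hΓ.1.discreteTopology_lattice
  have : IsZLattice ℝ M := ⟨hΓ.span_lattice⟩
  have : Module.Free ℤ M := ZLattice.module_free ℝ M
  have : Module.Finite ℤ M := ZLattice.module_finite ℝ M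
  exact ⟨_, ZLattice.isAddFundamentalDomain (Module.Free.chooseBasis ℤ M) volume⟩

/-- Unfolding: the integral over `ℝ^d` is that of the periodization over a fundamental domain of
`Λ`. -/
theorem integral_eq_zero_of_finsum_translates_ae_eq_zero (hΓ : IsSplittingCrystalGroup Γ)
    {h : E d → ℂ} (hint : Integrable h)
    (hfin : ∀ x, (Function.support fun k : lattice Γ => h ((k : E d) + x)).Finite)
    (hzero : ∀ᵐ x, ∑ᶠ k : lattice Γ, h ((k : E d) + x) = 0) : ∫ x, h x = 0 := by
  obtain ⟨S, hS⟩ := hΓ.exists_fundamentalDomain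
  have := hΓ.1.discreteTopology_lattice
  have : Countable (lattice Γ) := TopologicalSpace.separableSpace_iff_countable.1 inferInstance
  rw [hS.integral_eq_tsum'' h hint, ← integral_tsum]
  · refine (integral_congr_ae (ae_restrict_of_ae ?_)).trans (integral_zero _ _)
    filter_upwards [hzero] with x hx
    rw [← hx, tsum_eq_finsum]
    · rfl
    · exact hfin x
  · intro k
    exact ((measurePreserving_add_left volume (k : E d)).integrable_comp_of_integrable
      hint).aestronglyMeasurable.restrict
  · have h1 := hS.lintegral_eq_tsum'' fun x => ‖h x‖ₑ
    exact h1 ▸ hint.2.ne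

/-- The sum `∑_b f ∘ b` over the point group has integral `|G| ∫ f ≠ 0`, and its `Λ`-periodization
is the `Γ`-periodization of `f`. -/
theorem OrbitFinite.not_ae_eq_zero (hΓ : IsSplittingCrystalGroup Γ) [Finite (pointGroup Γ)]
    {f : E d → ℂ} (hf : OrbitFinite Γ f) (hfi : Integrable f) (hf0 : ∫ x, f x ≠ 0) :
    ¬ ∀ᵐ x : E d, ∑ᶠ γ : Γ, f ((γ : Isom d) x) = 0 := by
  intro hzero
  have := Fintype.ofFinite (pointGroup Γ)
  let h : E d → ℂ := fun x => ∑ b : pointGroup Γ, f ((b : E d ≃ₗᵢ[ℝ] E d) x)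
  have hcomp : ∀ b : pointGroup Γ, Integrable fun x => f ((b : E d ≃ₗᵢ[ℝ] E d) x) := fun b =>
    b.1.measurePreserving.integrable_comp_of_integrable hfi
  have hint : Integrable h := integrable_finsetSum _ fun b _ => hcomp b
  have hval : ∫ x, h x = Fintype.card (pointGroup Γ) • ∫ x, f x := by
    rw [integral_finsetSum _ fun b _ => hcomp b, Finset.sum_congr rfl fun b _ =>
      b.1.measurePreserving.integral_comp b.1.toHomeomorph.measurableEmbedding f]
    simp
  have hfinp : ∀ x, (Function.support fun a : pointGroup Γ × lattice Γ =>
      f ((a.1 : E d ≃ₗᵢ[ℝ] E d) ((a.2 : E d) + x))).Finite := fun x => by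
    refine ((hf.finite_support (fun _ => 1) x).preimage hΓ.eltEquiv.injective.injOn).subset ?_
    rintro ⟨b, k⟩ hbk
    simp only [mem_preimage, Function.mem_support, hΓ.eltEquiv_apply, one_mul]
    rwa [add_comm x]
  have hfinb : ∀ x, ∀ b : pointGroup Γ, (Function.support fun k : lattice Γ =>
      f ((b : E d ≃ₗᵢ[ℝ] E d) ((k : E d) + x))).Finite := fun x b =>
    (hfinp x).preimage (f := fun k => (b, k)) (Prod.mk_right_injective b).injOn
  have h0 := integral_eq_zero_of_finsum_translates_ae_eq_zero hΓ hint
    (fun x => ((Set.finite_univ (α := pointGroup Γ)).biUnion fun b _ => hfinb x b).subset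
      fun k hk => by
        obtain ⟨b, -, hb⟩ := Finset.exists_ne_zero_of_sum_ne_zero hk
        exact mem_biUnion (mem_univ b) hb) <| by
    filter_upwards [hzero] with x hx
    rw [finsum_sum_comm _ _ fun b _ => hfinb x b, ← finsum_eq_sum_of_fintype,
      ← finsum_curry _ (hfinp x), ← hx, ← finsum_comp_equiv hΓ.eltEquiv]
    refine finsum_congr fun a => ?_
    rw [← Prod.mk.eta (p := a), hΓ.eltEquiv_apply, add_comm x]
  rw [hval, smul_eq_zero] at h0
  exact h0.elim Fintype.card_ne_zero hf0

/-! ### The scalar refinement equation and its coset operators -/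

section

variable {r : ℕ}

/-- The lattice points `l` with `C (-l) ≠ 0`. -/
def negSupport (Γ : Subgroup (Isom d)) (C : E d →₀ Matrix (Fin r) (Fin r) ℂ) :
    Finset (lattice Γ) :=
  (C.support.finite_toSet.preimage (f := fun l : lattice Γ => -(l : E d))
    (fun _ _ _ _ h => Subtype.ext (neg_injective h))).toFinset

theorem mem_negSupport {C : E d →₀ Matrix (Fin r) (Fin r) ℂ} {l : lattice Γ} :
    l ∈ negSupport Γ C ↔ -(l : E d) ∈ C.support := by
  simp [negSupport]

/-- A finite set containing all `δ` with `c_{δ⁻¹} ≠ 0`. -/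
def refinementFinset [Fintype (pointGroup Γ)] (hΓ : IsSplittingCrystalGroup Γ)
    (C : E d →₀ Matrix (Fin r) (Fin r) ℂ) : Finset Γ :=
  ((Finset.univ : Finset (pointGroup Γ)) ×ˢ negSupport Γ C).map hΓ.eltEquiv.toEmbedding

theorem sum_refinementFinset [Fintype (pointGroup Γ)] (hΓ : IsSplittingCrystalGroup Γ)
    (C : E d →₀ Matrix (Fin r) (Fin r) ℂ) {M : Type*} [AddCommMonoid M] (G : Γ → M) :
    ∑ δ ∈ refinementFinset hΓ C, G δ =
      ∑ b : pointGroup Γ, ∑ l ∈ negSupport Γ C, G (hΓ.elt b l) := by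
  rw [refinementFinset, Finset.sum_map, Finset.sum_product]
  rfl

variable [NeZero r]

theorem inducedScalar_elt_inv (hΓ : IsSplittingCrystalGroup Γ) (g : Fin r ≃ pointGroup Γ)
    (C : E d →₀ Matrix (Fin r) (Fin r) ℂ) (b : pointGroup Γ) (l : lattice Γ) :
    inducedScalar g C (hΓ.elt b l)⁻¹ = C (-(l : E d)) 0 (g.symm b⁻¹) := by
  have h1 : (((hΓ.elt b l)⁻¹ : Γ) : Isom d) 0 = -(l : E d) := by
    have h : affineElt (b : E d ≃ₗᵢ[ℝ] E d) (l : E d) (-(l : E d)) = 0 := by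
      rw [affineElt_apply, neg_add_cancel, map_zero]
    exact (affineElt (b : E d ≃ₗᵢ[ℝ] E d) (l : E d)).symm_apply_eq.2 h.symm
  have h2 : (linearPart d) (((hΓ.elt b l)⁻¹ : Γ) : Isom d) = (b : E d ≃ₗᵢ[ℝ] E d)⁻¹ := by
    rw [Subgroup.coe_inv, map_inv]
    exact congrArg _ (linearPart_affineElt _ _)
  rw [inducedScalar, h1]
  exact congrArg (fun b => C (-(l : E d)) 0 (g.symm b)) (Subtype.ext h2)

/-- The `(Γ, A)`-symmetric refinement equation of the orbit vector is a scalar one for `f`. -/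
theorem isRefinable_of_orbitVector [Fintype (pointGroup Γ)] (hΓ : IsSplittingCrystalGroup Γ)
    (g : Fin r ≃ pointGroup Γ) {A : Matrix (Fin d) (Fin d) ℝ} (hA : IsAdmissible Γ A)
    {f : E d → ℂ} {C : E d →₀ Matrix (Fin r) (Fin r) ℂ}
    (hC : SatisfiesRefinementEq (lattice Γ) A C (orbitVector g f)) (hsymm : HasSymmetry g A C) :
    IsRefinable A (refinementFinset hΓ C) (fun δ => inducedScalar g C δ⁻¹) f := by
  obtain ⟨h, ρ, hh, hρ, hCs⟩ := hsymm
  -- The identity of `G` need not have index `0`. The component of `F` equal to `f` is the `i`-th,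
  -- and the symmetry identifies row `i` of `C k` with row `0`.
  set i := g.symm 1 with hi
  have hgi : g i = 1 := g.apply_symm_apply 1
  have hghi : g (h i) = 1 := by
    refine Subtype.ext (LinearIsometryEquiv.ext fun x => ?_)
    have := hh i (act A⁻¹ x)
    rw [hgi, hA.isExpanding.act_act_inv] at this
    exact this.trans (hA.isExpanding.act_act_inv x)
  have hrow : ∀ k ∈ lattice Γ, ∀ j, C k i j = C k 0 j := by
    intro k hk j
    have hρj : ρ i j = j := g.injective (by rw [hρ, hghi, inv_one, one_mul])
    rw [hCs i j k hk, hρj, hghi]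
    rfl
  filter_upwards [hC.2] with x hx
  have hx := congrFun hx i
  have hfx : orbitVector g f x i = f x := by
    simp only [orbitVector, hgi]
    rfl
  rw [hfx] at hx
  rw [hx, Finsupp.sum, Finset.sum_apply, sum_refinementFinset, Finset.sum_comm]
  symm
  refine Finset.sum_bij (fun l _ => -(l : E d)) (fun l hl => mem_negSupport.1 hl)
    (fun _ _ _ _ h => Subtype.ext (neg_injective h)) (fun k hk => ?_) fun l hl => ?_
  · have hkΛ : k ∈ lattice Γ := hC.1 hk
    exact ⟨-⟨k, hkΛ⟩, mem_negSupport.2 (by simpa using hk), by simp⟩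
  · rw [Matrix.mulVec, dotProduct, ← (g.trans (Equiv.inv (pointGroup Γ))).sum_comp]
    refine Finset.sum_congr rfl fun j _ => ?_
    rw [hrow _ (neg_mem l.2), inducedScalar_elt_inv]
    simp only [Equiv.trans_apply, Equiv.inv_apply, inv_inv, Equiv.symm_apply_apply, orbitVector,
      sub_neg_eq_add]
    congr 2
    exact affineElt_apply _ _ _

/-- Since `h` is a permutation, conjugation by `A` maps `G` onto `G`; admissibility alone is stated
as an inclusion. -/
theorem HasSymmetry.exists_conj {g : Fin r ≃ pointGroup Γ} {A : Matrix (Fin d) (Fin d) ℝ}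
    {C : E d →₀ Matrix (Fin r) (Fin r) ℂ} (hsymm : HasSymmetry g A C) (b : pointGroup Γ) :
    ∃ b' : pointGroup Γ, ∀ x : E d,
      (b : E d ≃ₗᵢ[ℝ] E d) (act A x) = act A ((b' : E d ≃ₗᵢ[ℝ] E d) x) := by
  obtain ⟨h, -, hh, -, -⟩ := hsymm
  refine ⟨g (h.symm (g.symm b)), fun x => ?_⟩
  have := hh (h.symm (g.symm b)) x
  rwa [Equiv.apply_symm_apply, Equiv.apply_symm_apply] at this

/-- Linear parts can always be matched because `A⁻¹ G A ⊆ G`, so only a congruence of translation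
parts modulo `A Λ` remains. Evaluating at the zero `-k` of `γ` isolates it. -/
theorem sameCoset_elt_iff (hΓ : IsSplittingCrystalGroup Γ) {A : Matrix (Fin d) (Fin d) ℝ}
    (hconj : ∀ b : pointGroup Γ, ∃ b' : pointGroup Γ, ∀ x : E d,
      (b : E d ≃ₗᵢ[ℝ] E d) (act A x) = act A ((b' : E d ≃ₗᵢ[ℝ] E d) x))
    (b₀ b : pointGroup Γ) (l₀ l : lattice Γ) :
    SameCoset Γ A (hΓ.elt b₀ l₀ : Isom d) (hΓ.elt b l) ↔
      ∃ k ∈ lattice Γ, (l : E d) - ((b⁻¹ * b₀ : pointGroup Γ) : E d ≃ₗᵢ[ℝ] E d) l₀ = act A k := by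
  obtain ⟨b', hb'⟩ := hconj (b⁻¹ * b₀)
  set u := ((b⁻¹ * b₀ : pointGroup Γ) : E d ≃ₗᵢ[ℝ] E d) with hu
  have hbu : ∀ x, (b : E d ≃ₗᵢ[ℝ] E d) (u x) = (b₀ : E d ≃ₗᵢ[ℝ] E d) x := fun x =>
    (b : E d ≃ₗᵢ[ℝ] E d).apply_symm_apply _
  have happ : ∀ (b : pointGroup Γ) (l : lattice Γ) (x : E d),
      (hΓ.elt b l : Isom d) x = (b : E d ≃ₗᵢ[ℝ] E d) (x + l) := fun b l x => affineElt_apply _ _ _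
  constructor
  · rintro ⟨γ, hγ, h⟩
    obtain ⟨⟨c, k⟩, hck⟩ := hΓ.eltEquiv.surjective ⟨γ, hγ⟩
    have hγx : ∀ x, γ x = (c : E d ≃ₗᵢ[ℝ] E d) (x + k) := fun x => by
      rw [← hΓ.eltEquiv_apply, hck]
    have h1 := h (-(k : E d))
    rw [happ, happ, hγx, neg_add_cancel, map_zero, act_zero, zero_add, ← hbu] at h1
    have h2 := (b : E d ≃ₗᵢ[ℝ] E d).injective h1
    refine ⟨_, pointGroup_apply_mem_lattice b'.2 (neg_mem k.2), ?_⟩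
    rw [← h2, map_add, add_sub_cancel_right, hb']
  · rintro ⟨k, hk, h⟩
    have hk' : (b'⁻¹ : pointGroup Γ).1 (-k) ∈ lattice Γ :=
      pointGroup_apply_mem_lattice (b'⁻¹).2 (neg_mem hk)
    refine ⟨_, (hΓ.elt b' ⟨_, hk'⟩).2, fun x => ?_⟩
    have h4 : (b' : E d ≃ₗᵢ[ℝ] E d) ((b'⁻¹ : pointGroup Γ).1 (-k)) = -k :=
      (b' : E d ≃ₗᵢ[ℝ] E d).apply_symm_apply _
    have h3 : act A (-k) = -act A k := map_neg _ _
    rw [happ, happ, happ, map_add (b' : E d ≃ₗᵢ[ℝ] E d), h4, act_add, h3, ← hb', ← h, ← hbu,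
      map_add u]
    congr 1
    abel

open Classical in
/-- The sum of `c_{(b, l)⁻¹} q(l)` over the coset `u + A Λ`. -/
def cosetSum (hΓ : IsSplittingCrystalGroup Γ) (g : Fin r ≃ pointGroup Γ)
    (A : Matrix (Fin d) (Fin d) ℝ) (C : E d →₀ Matrix (Fin r) (Fin r) ℂ) (b : pointGroup Γ)
    (u : E d) : (E d → ℂ) →ₗ[ℂ] ℂ :=
  ∑ l ∈ negSupport Γ C, (if ∃ k ∈ lattice Γ, (l : E d) - u = act A k then
    inducedScalar g C (hΓ.elt b l)⁻¹ else 0) • LinearMap.proj (l : E d)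

open Classical in
theorem cosetSum_apply (hΓ : IsSplittingCrystalGroup Γ) (g : Fin r ≃ pointGroup Γ)
    (A : Matrix (Fin d) (Fin d) ℝ) (C : E d →₀ Matrix (Fin r) (Fin r) ℂ) (b : pointGroup Γ)
    (u : E d) (q : E d → ℂ) : cosetSum hΓ g A C b u q =
      ∑ l ∈ negSupport Γ C, (if ∃ k ∈ lattice Γ, (l : E d) - u = act A k then
        inducedScalar g C (hΓ.elt b l)⁻¹ else 0) * q l := by
  simp only [cosetSum, LinearMap.sum_apply, LinearMap.smul_apply, LinearMap.proj_apply,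
    smul_eq_mul]

theorem finsum_coset_eq_cosetSum (hΓ : IsSplittingCrystalGroup Γ) (g : Fin r ≃ pointGroup Γ)
    (A : Matrix (Fin d) (Fin d) ℝ) (C : E d →₀ Matrix (Fin r) (Fin r) ℂ) (b : pointGroup Γ)
    (u : E d) (q : E d → ℂ) :
    ∑ᶠ (l : lattice Γ) (_ : ∃ k ∈ lattice Γ, (l : E d) - u = act A k),
      q (l : E d) * inducedScalar g C (hΓ.elt b l)⁻¹ = cosetSum hΓ g A C b u q := by
  classical
  rw [cosetSum_apply]
  have h : ∀ l : lattice Γ, (∑ᶠ (_ : ∃ k ∈ lattice Γ, (l : E d) - u = act A k),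
      q (l : E d) * inducedScalar g C (hΓ.elt b l)⁻¹) =
      (if ∃ k ∈ lattice Γ, (l : E d) - u = act A k then
        inducedScalar g C (hΓ.elt b l)⁻¹ else 0) * q l := fun l => by
    rw [finsum_eq_if, ite_mul, zero_mul, mul_comm]
  simp only [h]
  refine finsum_eq_sum_of_support_subset _ fun l hl => ?_
  have h1 := (ite_ne_right_iff.1 (left_ne_zero_of_mul hl)).2
  rw [inducedScalar_elt_inv] at h1
  refine Finset.mem_coe.2 (mem_negSupport.2 (Finsupp.mem_support_iff.2 fun h0 => h1 ?_))
  rw [h0]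
  rfl

theorem cosetOperator_elt_apply [Fintype (pointGroup Γ)] (hΓ : IsSplittingCrystalGroup Γ)
    (g : Fin r ≃ pointGroup Γ) {A : Matrix (Fin d) (Fin d) ℝ}
    (C : E d →₀ Matrix (Fin r) (Fin r) ℂ)
    (hconj : ∀ b : pointGroup Γ, ∃ b' : pointGroup Γ, ∀ x : E d,
      (b : E d ≃ₗᵢ[ℝ] E d) (act A x) = act A ((b' : E d ≃ₗᵢ[ℝ] E d) x))
    (b₀ : pointGroup Γ) (l₀ : lattice Γ) (q : E d → ℂ) (x : E d) :
    cosetOperator A (refinementFinset hΓ C) (fun δ => inducedScalar g C δ⁻¹) (hΓ.elt b₀ l₀) q x =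
      ∑ b : pointGroup Γ,
        cosetSum hΓ g A C b (((b⁻¹ * b₀ : pointGroup Γ) : E d ≃ₗᵢ[ℝ] E d) l₀)
          fun l => q ((b : E d ≃ₗᵢ[ℝ] E d) (l + act A x)) := by
  classical
  rw [cosetOperator_apply, Finset.sum_filter, Finset.sum_apply, sum_refinementFinset]
  refine Finset.sum_congr rfl fun b _ => ?_
  rw [cosetSum_apply]
  refine Finset.sum_congr rfl fun l _ => ?_
  simp only [sameCoset_elt_iff hΓ hconj]
  split_ifs
  · rw [add_comm (l : E d), Pi.smul_apply, smul_eq_mul]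
    congr 2
    exact affineElt_apply _ _ _
  · simp

/-- Changing `σ` only moves the coset of `A Λ` over which each `cosetSum` runs; the summed function
is a polynomial in `l` of degree below `p`, for which `hβ` removes this dependence. -/
theorem cosetOperator_eq [Fintype (pointGroup Γ)] (hΓ : IsSplittingCrystalGroup Γ)
    (g : Fin r ≃ pointGroup Γ) {A : Matrix (Fin d) (Fin d) ℝ}
    (C : E d →₀ Matrix (Fin r) (Fin r) ℂ)
    (hconj : ∀ b : pointGroup Γ, ∃ b' : pointGroup Γ, ∀ x : E d,
      (b : E d ≃ₗᵢ[ℝ] E d) (act A x) = act A ((b' : E d ≃ₗᵢ[ℝ] E d) x))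
    {p : ℕ} (hβ : ∀ b : pointGroup Γ, ∀ α : Fin d →₀ ℕ, α.degree < p → ∀ u ∈ lattice Γ,
      cosetSum hΓ g A C b u (monom α) = cosetSum hΓ g A C b 0 (monom α))
    (σ : Γ) {q : E d → ℂ} (hq : q ∈ polyFun d p) :
    cosetOperator A (refinementFinset hΓ C) (fun δ => inducedScalar g C δ⁻¹) σ q =
      cosetOperator A (refinementFinset hΓ C) (fun δ => inducedScalar g C δ⁻¹) (hΓ.elt 1 0) q := by
  obtain ⟨⟨b₀, l₀⟩, rfl⟩ := hΓ.eltEquiv.surjective σ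
  funext x
  refine (cosetOperator_elt_apply hΓ g C hconj b₀ l₀ q x).trans
    (Eq.trans ?_ (cosetOperator_elt_apply hΓ g C hconj 1 0 q x).symm)
  refine Finset.sum_congr rfl fun b _ => ?_
  rw [ZeroMemClass.coe_zero, map_zero]
  have hmem : (fun l => q ((b : E d ≃ₗᵢ[ℝ] E d) (l + act A x))) ∈ polyFun d p :=
    comp_add_mem_polyFun (comp_linearIsometry_mem_polyFun hq _) _
  refine LinearMap.eqOn_span ?_ hmem
  rintro _ ⟨α, hα, rfl⟩
  exact hβ b α hα _ (pointGroup_apply_mem_lattice (b⁻¹ * b₀).2 l₀.2)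

theorem act_isomMatrix (b : E d ≃ₗᵢ[ℝ] E d) (x : E d) : act (isomMatrix b) x = b x := by
  have h : b x = ∑ j, x j • b (EuclideanSpace.single j 1) := by
    conv_lhs => rw [← (EuclideanSpace.basisFun (Fin d) ℝ).sum_repr x]
    simp
  ext i
  rw [h]
  simp [act, isomMatrix, Matrix.mulVec, dotProduct, mul_comm]

/-- Dropping the shift `l` from `q (b (A x + l))` changes it only in lower degree, so the leading
form sees only the sums `β_{b,0}`. -/
theorem cosetOperator_sub_mem_polyFun [Fintype (pointGroup Γ)] (hΓ : IsSplittingCrystalGroup Γ)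
    (g : Fin r ≃ pointGroup Γ) {A : Matrix (Fin d) (Fin d) ℝ}
    (C : E d →₀ Matrix (Fin r) (Fin r) ℂ)
    (hconj : ∀ b : pointGroup Γ, ∃ b' : pointGroup Γ, ∀ x : E d,
      (b : E d ≃ₗᵢ[ℝ] E d) (act A x) = act A ((b' : E d ≃ₗᵢ[ℝ] E d) x))
    {s : ℕ} {q : E d → ℂ} (hq : q ∈ polyFun d (s + 1)) :
    cosetOperator A (refinementFinset hΓ C) (fun δ => inducedScalar g C δ⁻¹) (hΓ.elt 1 0) q -
      ∑ b : pointGroup Γ, cosetSum hΓ g A C b 0 1 •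
        (fun x => q ((b : E d ≃ₗᵢ[ℝ] E d) (act A x))) ∈ polyFun d s := by
  classical
  have h : cosetOperator A (refinementFinset hΓ C) (fun δ => inducedScalar g C δ⁻¹)
      (hΓ.elt 1 0) q - ∑ b : pointGroup Γ, cosetSum hΓ g A C b 0 1 •
        (fun x => q ((b : E d ≃ₗᵢ[ℝ] E d) (act A x))) =
      ∑ b : pointGroup Γ, ∑ l ∈ negSupport Γ C,
        (if ∃ k ∈ lattice Γ, (l : E d) - 0 = act A k then
        inducedScalar g C (hΓ.elt b l)⁻¹ else 0) • fun x : E d =>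
          ((fun y => q ((b : E d ≃ₗᵢ[ℝ] E d) (y + l))) - fun y => q ((b : E d ≃ₗᵢ[ℝ] E d) y))
            (act A x) := by
    funext x
    rw [Pi.sub_apply, cosetOperator_elt_apply hΓ g C hconj]
    simp only [ZeroMemClass.coe_zero, map_zero, Finset.sum_apply, ← Finset.sum_sub_distrib,
      cosetSum_apply, Pi.smul_apply, smul_eq_mul, Pi.sub_apply, Pi.one_apply, mul_one,
      Finset.sum_mul, mul_sub, add_comm (act A x)]
  rw [h]
  exact sum_mem fun b _ => sum_mem fun l _ => Submodule.smul_mem _ _ (comp_act_mem_polyFun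
    (translate_sub_mem_polyFun (comp_linearIsometry_mem_polyFun hq _) _) A)

/-- If `1` is not an eigenvalue of `∑_b β_b b_[s] A_[s]`, then `q ↦ ∑_b β_b q ∘ b ∘ A` fixes no
form of degree `s` modulo lower terms. -/
theorem mem_polyFun_of_sum_comp_sub_mem {ι : Type*} [Fintype ι] {s : ℕ}
    {A : Matrix (Fin d) (Fin d) ℝ} (b : ι → E d ≃ₗᵢ[ℝ] E d) (β : ι → ℂ)
    (h1 : ¬ Module.End.HasEigenvalue (Matrix.toLin'
      (∑ i, β i • (homMatrix (isomMatrix (b i)) s * homMatrix A s))) 1)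
    {q : E d → ℂ} (hq : q ∈ polyFun d (s + 1))
    (hfix : ∑ i, β i • (fun x => q (b i (act A x))) - q ∈ polyFun d s) : q ∈ polyFun d s := by
  obtain ⟨a, ha⟩ := exists_form_of_mem_polyFun hq
  set M := ∑ i, β i • (homMatrix (isomMatrix (b i)) s * homMatrix A s) with hM
  set φ : E d → ℂ := ∑ α, a α • (monom α.1 : E d → ℂ) with hφ
  have hcomp : ∑ i, β i • (fun x => φ (b i (act A x))) =
      ∑ α, (Matrix.vecMul a M) α • (monom α.1 : E d → ℂ) := by
    funext x
    have hb : ∀ i, φ (b i (act A x)) = a ⬝ᵥ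
        (homMatrix (isomMatrix (b i)) s * homMatrix A s).mulVec (fun α => monom α.1 x) := by
      intro i
      rw [← Matrix.mulVec_mulVec, homMatrix_mulVec, homMatrix_mulVec]
      simp [hφ, dotProduct, act_isomMatrix]
    have hr : (∑ α, (Matrix.vecMul a M) α • (monom α.1 : E d → ℂ)) x =
        Matrix.vecMul a M ⬝ᵥ fun α => monom α.1 x := by simp [dotProduct]
    rw [hr, ← Matrix.dotProduct_mulVec, hM, Matrix.sum_mulVec, dotProduct_sum]
    simp [hb, Matrix.smul_mulVec]
  have hform : ∑ α, (Matrix.vecMul a M - a) α • (monom α.1 : E d → ℂ) ∈ polyFun d s := by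
    have h2 : ∑ i, β i • (fun x => (q - φ) (b i (act A x))) - (q - φ) ∈ polyFun d s :=
      sub_mem (sum_mem fun i _ => Submodule.smul_mem _ _
        (comp_act_mem_polyFun (comp_linearIsometry_mem_polyFun ha (b i)) A)) ha
    have h3 := sub_mem hfix h2
    convert h3 using 1
    simp only [Pi.sub_apply, sub_smul, Finset.sum_sub_distrib, ← hcomp, ← hφ]
    funext x
    simp only [Pi.sub_apply, Finset.sum_apply, Pi.smul_apply, smul_eq_mul, mul_sub,
      Finset.sum_sub_distrib]
    ring
  have hfixed := form_eq_zero_of_mem_polyFun hform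
  have ha0 : a = 0 := by
    by_contra hne
    -- The coefficient row `a` is a left fixed vector of `M`; the determinant converts it into a
    -- right eigenvector.
    have hdet : (M - 1).det = 0 := Matrix.exists_vecMul_eq_zero_iff.1
      ⟨a, hne, by rw [Matrix.vecMul_sub, Matrix.vecMul_one, hfixed]⟩
    obtain ⟨v, hv, hv0⟩ := Matrix.exists_mulVec_eq_zero_iff.2 hdet
    refine h1 (Module.End.hasEigenvalue_of_hasEigenvector (x := v) ⟨?_, hv⟩)
    rw [Module.End.mem_eigenspace_iff, Matrix.toLin'_apply, one_smul]
    rwa [Matrix.sub_mulVec, Matrix.one_mulVec, sub_eq_zero] at hv0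
  simpa [hφ, ha0] using ha

end

/-! ### The invariant functional and polynomial reproduction -/

/-- A triangular operator fixing `1` and no higher form modulo lower terms admits an invariant
functional normalized at `1`. -/
theorem exists_invariant_functional {p : ℕ} (T : (E d → ℂ) →ₗ[ℂ] (E d → ℂ)) (hT : T 1 = 1)
    (hS : ∀ s, 1 ≤ s → s < p → ∀ q ∈ polyFun d (s + 1), T q - q ∈ polyFun d s →
      q ∈ polyFun d s) :
    ∃ L : (E d → ℂ) →ₗ[ℂ] ℂ, L 1 = 1 ∧ ∀ q ∈ polyFun d p, L (T q) = L q := by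
  have hne : (1 : E d → ℂ) ≠ 0 := one_ne_zero
  -- For `s ≥ 1` the constant `1` has degree below `s`, so `T q - q = 1` lets `hS` lower the degree
  -- of `q` until it is constant, where `T q - q = 0`.
  have h : ∀ s ≤ p, ∀ q ∈ polyFun d s, T q - q ≠ 1 := by
    intro s
    induction s with
    | zero =>
      intro _ q hq h
      rw [polyFun_zero, Submodule.mem_bot] at hq
      rw [hq, map_zero, sub_zero] at h
      exact hne h.symm
    | succ s ih =>
      intro hs q hq h
      rcases Nat.eq_zero_or_pos s with rfl | hs0
      · rw [polyFun_one, Submodule.mem_span_singleton] at hq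
        obtain ⟨a, rfl⟩ := hq
        rw [map_smul, hT, sub_self] at h
        exact hne h.symm
      · exact ih (by omega) q (hS s hs0 hs q hq (h ▸ one_mem_polyFun hs0)) h
  have hmem : (1 : E d → ℂ) ∉ (polyFun d p).map (T - LinearMap.id) := by
    rintro ⟨q, hq, h1⟩
    exact h p le_rfl q hq h1
  obtain ⟨L, hL1, hL⟩ := Submodule.exists_le_ker_of_notMem hmem
  refine ⟨(L 1)⁻¹ • L, by simp [hL1], fun q hq => ?_⟩
  have h1 : L (T q - q) = 0 := hL (Submodule.mem_map_of_mem hq)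
  rw [map_sub, sub_eq_zero] at h1
  simp [h1]

theorem orbitSum_one_of_apply_one {f : E d → ℂ} (hf : OrbitFinite Γ f)
    {L : (E d → ℂ) →ₗ[ℂ] ℂ} (hL : L 1 = 1) (x : E d) :
    hf.orbitSum L 1 x = ∑ᶠ γ : Γ, f ((γ : Isom d) x) := by
  rw [OrbitFinite.orbitSum_apply]
  refine finsum_congr fun γ => ?_
  have : (fun y : E d => (1 : E d → ℂ) ((γ : Isom d)⁻¹ y)) = 1 := rfl
  rw [this, hL, one_mul]

/-- The `Γ`-periodization of `f` is a nonzero constant, and the coset operator fixes `1`. -/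
theorem exists_finsum_ae_eq_const (hΓ : IsSplittingCrystalGroup Γ) [Finite (pointGroup Γ)]
    {A : Matrix (Fin d) (Fin d) ℝ} (hA : IsAdmissible Γ A) {f : E d → ℂ}
    (hf : OrbitFinite Γ f) (hfi : Integrable f) (hf0 : ∫ x, f x ≠ 0) {D : Finset Γ} {c : Γ → ℂ}
    (hD : IsRefinable A D c f) {e : Γ}
    (he : ∀ σ, cosetOperator A D c σ 1 = cosetOperator A D c e 1) :
    cosetOperator A D c e 1 = 1 ∧
      ∃ a : ℂ, a ≠ 0 ∧ ∀ᵐ x, ∑ᶠ γ : Γ, f ((γ : Isom d) x) = a := by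
  classical
  have := hΓ.countable
  obtain ⟨β, hβ⟩ : ∃ β : ℂ, cosetOperator A D c e 1 = β • (1 : E d → ℂ) := by
    refine ⟨∑ δ ∈ D.filter fun δ : Γ => SameCoset Γ A (e : Isom d) δ, c δ, ?_⟩
    rw [cosetOperator_apply, Finset.sum_smul]
    rfl
  -- Any functional with `L 1 = 1` would do: only its value on constants enters.
  let L : (E d → ℂ) →ₗ[ℂ] ℂ := LinearMap.proj 0
  have hL : L 1 = 1 := rfl
  have hP := orbitSum_one_of_apply_one hf hL
  set P := hf.orbitSum L 1
  have hact : P =ᵐ[volume] fun x => β * P (act A x) := by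
    filter_upwards [hf.orbitSum_comp_act L hA hD 1] with x hx
    rw [hP (act A x), mul_finsum' _ _ <| by
      have h := hf.finite_support (fun _ => 1) (act A x)
      simp only [one_mul] at h
      exact h]
    refine hx.trans (finsum_congr fun σ => ?_)
    have h1 : (fun y : E d => (1 : E d → ℂ) ((σ : Isom d)⁻¹ y)) = 1 := rfl
    rw [h1, he, hβ, map_smul, hL, smul_eq_mul, mul_one]
  have hper : ∀ k ∈ lattice Γ, ∀ x, P (x + k) = P x := by
    intro k hk x
    have h1 := hf.orbitSum_comp L 1 ⟨translation k, hk⟩ x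
    rw [translation_apply] at h1
    exact h1
  have hpull : ∀ n : ℕ, P =ᵐ[volume] fun x => β ^ n * P ((act A)^[n] x) := by
    intro n
    induction n with
    | zero => simp
    | succ n ih =>
      filter_upwards [ih, (hA.isExpanding.quasiMeasurePreserving.iterate n).ae_eq_comp hact]
        with x h1 h2
      simp only [Function.comp_apply] at h2
      rw [h1, h2, Function.iterate_succ_apply', pow_succ, mul_assoc]
  obtain ⟨R, hR⟩ := hΓ.exists_lattice_near
  obtain ⟨a, ha⟩ := ae_eq_const_of_periodic_of_comp_act hA.isExpanding (Λ := lattice Γ) hR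
    (hf.locallyIntegrable hfi _) fun n => ⟨fun x => β ^ n * P x, fun k hk =>
      Eventually.of_forall fun x => congrArg (β ^ n * ·) (hper k hk x), hpull n⟩
  have ha : P =ᵐ[volume] fun _ => a := ha
  have hne : ¬ ∀ᵐ x, P x = 0 := fun h => hf.not_ae_eq_zero hΓ hfi hf0 <| by
    filter_upwards [h] with x hx
    rw [← hP, hx]
  have ha0 : a ≠ 0 := by
    rintro rfl
    exact hne ha
  refine ⟨?_, a, ha0, ?_⟩
  · obtain ⟨x, h1, h2, h3⟩ := (ha.and (hact.and
      (hA.isExpanding.quasiMeasurePreserving.ae_eq_comp ha))).exists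
    simp only [Function.comp_apply] at h1 h2 h3
    rw [h1, h3] at h2
    have : β = 1 := mul_right_cancel₀ ha0 (by rw [one_mul]; exact h2.symm)
    rw [hβ, this, one_smul]
  · filter_upwards [ha] with x hx
    rw [← hP, hx]

theorem exists_orbitSum_ae_eq (hΓ : IsSplittingCrystalGroup Γ) [Finite (pointGroup Γ)]
    {A : Matrix (Fin d) (Fin d) ℝ} (hA : IsAdmissible Γ A) {f : E d → ℂ}
    (hf : OrbitFinite Γ f) (hfi : Integrable f) (hf0 : ∫ x, f x ≠ 0) {D : Finset Γ} {c : Γ → ℂ}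
    (hD : IsRefinable A D c f) {e : Γ} {p : ℕ} (hp : 0 < p)
    (he : ∀ σ, ∀ q ∈ polyFun d p, cosetOperator A D c σ q = cosetOperator A D c e q)
    (hS : ∀ s, 1 ≤ s → s < p → ∀ q ∈ polyFun d (s + 1),
      cosetOperator A D c e q - q ∈ polyFun d s → q ∈ polyFun d s) :
    ∃ (L : (E d → ℂ) →ₗ[ℂ] ℂ) (a : ℂ), a ≠ 0 ∧
      ∀ q ∈ polyFun d p, ∀ᵐ x, hf.orbitSum L q x = a * q x := by
  have := hΓ.countable
  obtain ⟨hT, a, ha0, ha⟩ := exists_finsum_ae_eq_const hΓ hA hf hfi hf0 hD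
    fun σ => he σ 1 (one_mem_polyFun hp)
  obtain ⟨L, hL1, hL⟩ := exists_invariant_functional (cosetOperator A D c e) hT hS
  obtain ⟨R, hR⟩ := hΓ.exists_lattice_near
  refine ⟨L, a, ha0, fun q hq => ?_⟩
  let Φ : (E d → ℂ) →ₗ[ℂ] (E d → ℂ) := hf.orbitSum L - a • LinearMap.id
  have hΦ : ∀ q x, Φ q x = hf.orbitSum L q x - a * q x := fun _ _ => rfl
  have hloc : ∀ q ∈ polyFun d p, LocallyIntegrable (Φ q) := fun q hq =>
    (hf.locallyIntegrable hfi fun γ => L fun y => q ((γ : Isom d)⁻¹ y)).sub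
      ((continuous_of_mem_polyFun hq).const_smul a).locallyIntegrable
  have htr : ∀ q, ∀ k ∈ (lattice Γ : Set (E d)), ∀ x,
      Φ q (x + k) = Φ (fun y => q (y + k)) x := fun q k hk x => by
    have h1 := hf.orbitSum_comp L q ⟨translation k, hk⟩ x
    simp only [translation_apply] at h1
    rw [hΦ, hΦ, h1]
  have hact : ∀ q ∈ polyFun d p, Φ (fun x => q (act A x)) =ᵐ[volume] Φ q ∘ act A := by
    intro q hq
    filter_upwards [hf.orbitSum_comp_act L hA hD q] with x hx
    rw [Function.comp_apply, hΦ, hΦ, hx, hf.orbitSum_apply]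
    congr 1
    refine finsum_congr fun σ => ?_
    have h1 := comp_isom_mem_polyFun hq (σ : Isom d)⁻¹
    rw [he σ _ h1, hL _ h1]
  have hone : Φ 1 =ᵐ[volume] 0 := by
    filter_upwards [ha] with x hx
    rw [hΦ, orbitSum_one_of_apply_one hf hL1, hx]
    simp
  filter_upwards [ae_eq_zero_of_equivariant hA.isExpanding hR Φ hloc htr hact hone p le_rfl q hq]
    with x hx
  exact sub_eq_zero.1 hx

/-- The component `F_i (x + k) = f (g_i⁻¹ (x + k))` is `f (γ x)` for `γ = (g_i⁻¹, k)`, so summing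
over `Γ` is summing over `Λ` and over components. -/
theorem mem_translateSpace_of_orbitSum {r : ℕ} (hΓ : IsSplittingCrystalGroup Γ)
    (g : Fin r ≃ pointGroup Γ) {f : E d → ℂ} (hf : OrbitFinite Γ f) (L : (E d → ℂ) →ₗ[ℂ] ℂ)
    {a : ℂ} (ha : a ≠ 0) {q : E d → ℂ} (hq : ∀ᵐ x, hf.orbitSum L q x = a * q x) :
    q ∈ translateSpace (lattice Γ) (orbitVector g f) := by
  let θ : lattice Γ × Fin r ≃ Γ :=
    ((Equiv.prodComm _ _).trans
      ((g.trans (Equiv.inv _)).prodCongr (Equiv.refl _))).trans hΓ.eltEquiv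
  have hθ : ∀ k i x, (θ (k, i) : Isom d) x = (g i : E d ≃ₗᵢ[ℝ] E d).symm (x + k) :=
    fun k i x => hΓ.eltEquiv_apply (g i)⁻¹ k x
  let w : Γ → ℂ := fun γ => a⁻¹ * L fun y => q ((γ : Isom d)⁻¹ y)
  refine ⟨fun k i => w (θ (k, i)), ?_⟩
  filter_upwards [hq] with x hx
  have hfin : (Function.support fun t : lattice Γ × Fin r =>
      w (θ t) * f ((θ t : Isom d) x)).Finite :=
    (hf.finite_support w x).preimage θ.injective.injOn
  have hval : ∑ᶠ k : lattice Γ, ∑ i, w (θ (k, i)) * orbitVector g f (x + (k : E d)) i = q x := by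
    have h1 : q x = ∑ᶠ γ : Γ, w γ * f ((γ : Isom d) x) := by
      rw [← inv_mul_cancel_left₀ ha (q x), ← hx, hf.orbitSum_apply,
        mul_finsum' _ _ (hf.finite_support _ x)]
      exact finsum_congr fun γ => (mul_assoc _ _ _).symm
    rw [h1, ← finsum_comp_equiv θ, finsum_curry _ hfin]
    refine finsum_congr fun k => ?_
    rw [finsum_eq_sum_of_fintype]
    simp only [hθ, orbitVector]
  have hsupp : (Function.support fun k : lattice Γ =>
      ∑ i, w (θ (k, i)) * orbitVector g f (x + (k : E d)) i).Finite := by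
    refine (hfin.image Prod.fst).subset fun k hk => ?_
    obtain ⟨i, -, hi⟩ := Finset.exists_ne_zero_of_sum_ne_zero hk
    refine ⟨(k, i), ?_, rfl⟩
    simpa only [Function.mem_support, hθ, orbitVector] using hi
  rw [← hval, finsum_eq_sum _ hsupp]
  exact hasSum_sum_of_ne_finset_zero fun k hk => by
    simpa using hk

end Crystal

end

theorem mainTheorem5 {d r p : ℕ} [NeZero r]
    -- a splitting crystal group, its point group `{g_1, …, g_r}`, an admissible matrix
    (Γ : Subgroup (Crystal.Isom d)) (hΓ : Crystal.IsSplittingCrystalGroup Γ)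
    (g : Fin r ≃ Crystal.pointGroup Γ)
    (A : Matrix (Fin d) (Fin d) ℝ) (hA : Crystal.IsAdmissible Γ A)
    -- the scalar function `f`
    (f : Crystal.E d → ℂ) (hf : MeasureTheory.Integrable f) (hfc : HasCompactSupport f)
    (hf0 : ∫ x, f x ≠ 0)
    -- `F` is refinable along the lattice with symmetric coefficients `C_k`
    (C : Crystal.E d →₀ Matrix (Fin r) (Fin r) ℂ)
    (hC : Crystal.SatisfiesRefinementEq (Crystal.lattice Γ) A C (Crystal.orbitVector g f))
    (hsymm : Crystal.HasSymmetry g A C)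
    -- the hypotheses on the induced scalars
    (hc : Crystal.ScalarAccuracyConditions hΓ g A p (Crystal.inducedScalar g C))
    (hsq : ∑ᶠ γ : Γ, ‖Crystal.inducedScalar g C γ‖ ^ 2 < |A.det|) :
    Crystal.HasAccuracy (Crystal.lattice Γ) (Crystal.orbitVector g f) p := by
  intro q hq
  have hp : 0 < p := lt_of_le_of_lt (Nat.zero_le _) hq
  let _ : Fintype (Crystal.pointGroup Γ) := Fintype.ofEquiv _ g
  obtain ⟨-, β, hβ, hev⟩ := hc
  have hsum : ∀ b : Crystal.pointGroup Γ, ∀ α : Fin d →₀ ℕ, α.degree < p →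
      ∀ u ∈ Crystal.lattice Γ,
        Crystal.cosetSum hΓ g A C b u (Crystal.monom α) = β b α := fun b α hα u hu => by
    rw [← hβ b α hα ⟨u, hu⟩, Crystal.finsum_coset_eq_cosetSum]
  have horb := hΓ.orbitFinite hfc
  obtain ⟨L, a, ha, hL⟩ := Crystal.exists_orbitSum_ae_eq hΓ hA horb hf hf0
    (Crystal.isRefinable_of_orbitVector hΓ g hA hC hsymm) hp
    (fun σ q hq => Crystal.cosetOperator_eq hΓ g C hsymm.exists_conj
      (fun b α hα u hu => (hsum b α hα u hu).trans (hsum b α hα 0 (zero_mem _)).symm) σ hq)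
    (fun s hs hsp q hq hfix => by
      refine Crystal.mem_polyFun_of_sum_comp_sub_mem
        (fun i => (g i : Crystal.E d ≃ₗᵢ[ℝ] Crystal.E d)) (fun i => β (g i) 0) (hev s hs hsp) hq ?_
      -- Subtracting the two memberships cancels `T q` and leaves `∑_b β_{b,0} q ∘ b ∘ A - q`, the
      -- expression governed by the eigenvalue condition.
      have h1 := Crystal.cosetOperator_sub_mem_polyFun hΓ g C hsymm.exists_conj hq
      have h2 := sub_mem hfix h1
      rw [sub_sub_sub_cancel_left] at h2
      rw [← g.sum_comp] at h2
      simpa only [← Crystal.monom_zero, hsum _ 0 (by simpa using hp) 0 (zero_mem _)] using h2)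
  exact Crystal.mem_translateSpace_of_orbitSum hΓ g horb L ha
    (hL _ (Crystal.eval_mem_polyFun q hq))
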